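/- Let $\Sigma$ be a compact (connected) Riemann surface of genus $g$ with two distinct marked points $P_+,P_-$, and let $\mathfrak g$ be one of the complex matrix algebras $\mathfrak{gl}(n)$, $\mathfrak{sl}(n)$, $\mathfrak{so}(n)$, $\mathfrak s(n)$ (scalar $n\times n$ matrices), or $\mathfrak{sp}(2n)$ (the $X$ with $X^t\sigma+\sigma X=0$ for a fixed non-degenerate skew-symmetric $\sigma$). Fix $ng$ distinct points $W=\{\gamma_1,\dots,\gamma_{ng}\}\subset\Sigma\setminus\{P_+,P_-\}$, vectors $\alpha_s\in\mathbb C^n$ ($\mathbb C^{2n}$ for $\mathfrak{sp}(2n)$; $\alpha_s^t\alpha_s=0$ for $\mathfrak{so}(n)$), and local coordinates $z_\pm$ at $P_\pm$, $z_s$ at $\gamma_s$. The Lax operator algebra $\overline{\mathfrak g}$, with the pointwise commutator, consists of the meromorphic functions $L:\Sigma\to\mathfrak g$, holomorphic outside $W\cup\{P_+,P_-\}$, with an expansion $L=L_{s,-1}z_s^{-1}+L_{s,0}+O(z_s)$ at each $\gamma_s$ such that for some $\beta_s$, $\kappa_s$: $L_{s,-1}=\alpha_s\beta_s^t$ (for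 $\mathfrak{so}(n)$: $L_{s,-1}=\alpha_s\beta_s^t-\beta_s\alpha_s^t$), $\beta_s^t\alpha_s=0$, $L_{s,0}\alpha_s=\kappa_s\alpha_s$; for $\mathfrak{sp}(2n)$ instead $L=\nu_s\alpha_s\alpha_s^t\sigma z_s^{-2}+(\alpha_s\beta_s^t+\beta_s\alpha_s^t)\sigma z_s^{-1}+L_{s,0}+L_{s,1}z_s+O(z_s^2)$ with $\beta_s^t\sigma\alpha_s=0$, $L_{s,0}\alpha_s=\kappa_s\alpha_s$, $\alpha_s^t\sigma L_{s,1}\alpha_s=0$. A connection form $\omega$ is a meromorphic matrix-valued $1$-form ($\mathfrak g$-valued for $\mathfrak{so}(n),\mathfrak{sp}(2n)$, $\mathfrak{gl}(n)$-valued otherwise), holomorphic outside $W\cup\{P_+,P_-\}$ and at the $\gamma_s$ with $\alpha_s=0$, whose coefficient at the $\gamma_s$ with $\alpha_s\neq0$ satisfies the same expansion conditions (with $\nu_s=0$) except that $\beta_s^t\alpha_s=0$ (resp. $\beta_s^t\sigma\alpha_s=0$) is replaced by $\beta_s^t\alpha_s=1$ (resp. $\beta_s^t\sigma\alpha_s=1$).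 For a meromorphic vector field $e$ on $\Sigma$ put $\nabla^{(\omega)}_eL=e.L+[\omega(e),L]$. Let $\mathcal A$ be the algebra of meromorphic functions on $\Sigma$ holomorphic outside $\{P_+,P_-\}$, and let $(A_m)_{m\in\mathbb Z}$ be a Krichever--Novikov basis of it: a vector space basis with $A_m=z_+^m+O(z_+^{m+1})$ at $P_+$ and $\operatorname{ord}_{P_-}(A_m)\ge -m-c$ for a constant $c$ independent of $m$. For a subspace $V\subseteq\mathfrak g$ let $\overline V_m$ be the space of $V$-valued $L\in\overline{\mathfrak g}$ with $L=Y_+z_+^m+O(z_+^{m+1})$ and $L=Y_-z_-^{-m-g}+O(z_-^{-m-g+1})$ for some $Y_\pm\in V$. The homogeneous subspace $\overline{\mathfrak g}_m$ is $\{A_mY: Y\in\mathfrak g\}$ if all $\alpha_s=0$; otherwise it is $\overline V_m$ with $V=\mathfrak g$ if $m\ge1$ or $m\le -g-1$, and $\overline V_m+\{A_mY:Y\in\mathfrak g\text{ scalar}\}$ with $V=\{Y\in\mathfrak g:\operatorname{tr}Y=0\}$ if $-g\le m\le0$. Then, for all $L,L'\in\overline{\mathfrak g}$, $\operatorname{tr}(L)\cdot\operatorname{tr}(dL')$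 is a meromorphic differential on $\Sigma$ without poles outside $\{P_+,P_-\}$, and $$\gamma_2(L,L')=\operatorname{res}_{P_+}\big(\operatorname{tr}(L)\cdot\operatorname{tr}(dL')\big)$$ has the following properties. 1. $\gamma_2$ is a Lie algebra $2$-cocycle on $\overline{\mathfrak g}$: it is bilinear and antisymmetric, and $\gamma_2([L,L'],L'')+\gamma_2([L',L''],L)+\gamma_2([L'',L],L')=0$. 2. $\gamma_2$ is $\mathcal L$-invariant with respect to every connection form $\omega$: $\gamma_2(\nabla^{(\omega)}_eL,L')+\gamma_2(L,\nabla^{(\omega)}_eL')=0$ for all $L,L'\in\overline{\mathfrak g}$ and all meromorphic vector fields $e$ on $\Sigma$ holomorphic outside $\{P_+,P_-\}$. 3. $\gamma_2$ is local: there are $R,S\in\mathbb Z$ such that $\gamma_2(\overline{\mathfrak g}_k,\overline{\mathfrak g}_m)\neq0$ implies $R\le k+m\le S$. The same holds, with $R,S$ depending on the family, for every family $(G_m)_{m\in\mathbb Z}$ of subspaces of $\overline{\mathfrak g}$ for which there is a constant $c$ such that every $L\in G_m$ has order at least $m$ at $P_+$ and at least $-m-c$ at $P_-$. -/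

import Mathlib

open Filter
open scoped Manifold ContDiff Topology Matrix

noncomputable section

namespace LaxOperator

/-! ### Calculus on a Riemann surface -/

section RiemannSurface

variable (X : Type*) [TopologicalSpace X] [ChartedSpace ℂ X]

/-- (Not necessarily continuous) differential forms of type `(1,0)`: a `ℂ`-linear form on every
holomorphic tangent line. -/
abbrev OneForm : Type _ := (x : X) → (TangentSpace 𝓘(ℂ) x →L[ℂ] ℂ)

/-- (Not necessarily continuous) vector fields. -/
abbrev VField : Type _ := (x : X) → TangentSpace 𝓘(ℂ) x

variable {X}

/-- `z` is a holomorphic local coordinate centred at `p`. -/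
def IsCoord (z : OpenPartialHomeomorph X ℂ) (p : X) : Prop :=
  z ∈ IsManifold.maximalAtlas 𝓘(ℂ) ω X ∧ p ∈ z.source ∧ z p = 0

/-- The coordinate vector `d/dz` at the point with coordinate `w`. -/
def coordVec (z : OpenPartialHomeomorph X ℂ) (w : ℂ) : TangentSpace 𝓘(ℂ) (z.symm w) :=
  mfderiv 𝓘(ℂ) 𝓘(ℂ) z.symm w (1 : ℂ)

/-- The function `h` with `η = h dz` in the coordinate `z`. -/
def formCoeff (z : OpenPartialHomeomorph X ℂ) (η : OneForm X) : ℂ → ℂ :=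
  fun w => η (z.symm w) (coordVec z w)

/-- The function `h` with `e = h d/dz` in the coordinate `z`. -/
def fieldCoeff (z : OpenPartialHomeomorph X ℂ) (e : VField X) : ℂ → ℂ :=
  fun w => mfderiv 𝓘(ℂ) 𝓘(ℂ) z (z.symm w) (e (z.symm w))

/-- The differential `df` of a function. -/
def dfun (f : X → ℂ) : OneForm X := fun x => mfderiv 𝓘(ℂ) 𝓘(ℂ) f x

/-- A one-form is holomorphic at a point `p` (this is used for all points of an open set). -/
def HoloFormAt (η : OneForm X) (p : X) : Prop :=
  DifferentiableAt ℂ (formCoeff (chartAt ℂ p) η) (chartAt ℂ p p)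

/-- A vector field is holomorphic at a point `p` (this is used for all points of an open set). -/
def HoloFieldAt (e : VField X) (p : X) : Prop :=
  DifferentiableAt ℂ (fieldCoeff (chartAt ℂ p) e) (chartAt ℂ p p)

variable (X) in
/-- The space of holomorphic differentials. -/
def holomorphicForms : Submodule ℂ (OneForm X) where
  carrier := {η | ∀ p, HoloFormAt η p}
  zero_mem' := fun p => by
    have h : DifferentiableAt ℂ (fun _ : ℂ => (0 : ℂ)) (chartAt ℂ p p) :=
      differentiableAt_const _
    exact h
  add_mem' := fun {a b} ha hb p => (ha p).add (hb p)
  smul_mem' := fun c a ha p => by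
    have h : DifferentiableAt ℂ (fun w => c * formCoeff (chartAt ℂ p) a w) (chartAt ℂ p p) :=
      (ha p).const_mul c
    exact h

variable (X) in
/-- The genus: the dimension of the space of holomorphic differentials. -/
def genus : ℕ := Module.finrank ℂ (holomorphicForms X)

/-- The residue at `0` of a function of one complex variable, as the value of
`(1 / 2πi) ∮` over all sufficiently small circles. -/
def residueAtZero (F : ℂ → ℂ) : ℂ :=
  limUnder (𝓝[>] (0 : ℝ)) fun r : ℝ => (2 * Real.pi * Complex.I)⁻¹ * ∮ w in C(0, r), F w

end RiemannSurface

/-- `F(w) = O(w^k)` as `w → 0`, `w ≠ 0`, for scalar valued `F`. -/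
def IsOPow (F : ℂ → ℂ) (k : ℤ) : Prop := F =O[𝓝[≠] 0] fun w : ℂ => w ^ k

/-- `F(w) = O(w^k)` as `w → 0`, `w ≠ 0`, for matrix valued `F`. -/
def IsMatOPow {N : ℕ} (F : ℂ → Matrix (Fin N) (Fin N) ℂ) (k : ℤ) : Prop :=
  ∀ i j, IsOPow (fun w => F w i j) k

theorem IsMatOPow.zero {N : ℕ} (k : ℤ) :
    IsMatOPow (fun _ => (0 : Matrix (Fin N) (Fin N) ℂ)) k :=
  fun _ _ => Asymptotics.isBigO_zero _ _

theorem IsMatOPow.add {N : ℕ} {F G : ℂ → Matrix (Fin N) (Fin N) ℂ} {k : ℤ}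
    (hF : IsMatOPow F k) (hG : IsMatOPow G k) : IsMatOPow (fun w => F w + G w) k :=
  fun i j => Asymptotics.IsBigO.add (hF i j) (hG i j)

theorem IsMatOPow.smul {N : ℕ} {F : ℂ → Matrix (Fin N) (Fin N) ℂ} {k : ℤ} (c : ℂ)
    (hF : IsMatOPow F k) : IsMatOPow (fun w => c • F w) k :=
  fun i j => Asymptotics.IsBigO.const_mul_left (hF i j) c

/-! ### The finite-dimensional matrix algebras -/

/-- The matrix algebras `gl(n)`, `sl(n)`, `so(n)`, `s(n)` (scalar matrices), and `sp(2n)` for a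
non-degenerate skew-symmetric matrix `σ`.  The second index is the size of the matrices. -/
inductive MatAlg : ℕ → ℕ → Type
  | gl (n : ℕ) : MatAlg n n
  | sl (n : ℕ) : MatAlg n n
  | so (n : ℕ) : MatAlg n n
  | s (n : ℕ) : MatAlg n n
  | sp (n : ℕ) (σ : Matrix (Fin (2 * n)) (Fin (2 * n)) ℂ) (skew : σᵀ = -σ)
      (nondeg : IsUnit σ.det) : MatAlg n (2 * n)

namespace MatAlg

/-- The underlying space of matrices. -/
def carrier : {n N : ℕ} → MatAlg n N → Submodule ℂ (Matrix (Fin N) (Fin N) ℂ)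
  | _, _, gl _ => ⊤
  | n, _, sl _ => LinearMap.ker (Matrix.traceLinearMap (Fin n) ℂ ℂ)
  | n, _, so _ => skewAdjointMatricesSubmodule (1 : Matrix (Fin n) (Fin n) ℂ)
  | n, _, s _ => Submodule.span ℂ {(1 : Matrix (Fin n) (Fin n) ℂ)}
  | _, _, sp _ σ _ _ => skewAdjointMatricesSubmodule σ

/-- The algebra in which connection forms take values (all of `gl(n)` for `gl(n)` and its two
summands `sl(n)` and `s(n)`). -/
def connCarrier : {n N : ℕ} → MatAlg n N → Submodule ℂ (Matrix (Fin N) (Fin N) ℂ)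
  | _, _, gl _ => ⊤
  | _, _, sl _ => ⊤
  | n, _, so _ => (so n).carrier
  | _, _, s _ => ⊤
  | n, _, sp _ σ h h' => (sp n σ h h').carrier

/-- Traceless matrices of the algebra. -/
def tracelessPart {n N : ℕ} (A : MatAlg n N) : Submodule ℂ (Matrix (Fin N) (Fin N) ℂ) :=
  A.carrier ⊓ LinearMap.ker (Matrix.traceLinearMap (Fin N) ℂ ℂ)

/-- Scalar matrices of the algebra. -/
def scalarPart {n N : ℕ} (A : MatAlg n N) : Submodule ℂ (Matrix (Fin N) (Fin N) ℂ) :=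
  A.carrier ⊓ Submodule.span ℂ {(1 : Matrix (Fin N) (Fin N) ℂ)}

/-- The vectors admitted as Tyurin parameters: isotropic ones for `so(n)`, all otherwise. -/
def Admissible : {n N : ℕ} → MatAlg n N → (Fin N → ℂ) → Prop
  | _, _, so _, α => α ⬝ᵥ α = 0
  | _, _, _, _ => True

end MatAlg

section Expansions

variable {N : ℕ}

/-- Behaviour of a Lax operator at a weak singularity for `gl(n)` (and `sl(n)`, `s(n)`). -/
def GLWeak (α : Fin N → ℂ) (F : ℂ → Matrix (Fin N) (Fin N) ℂ) : Prop :=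
  ∃ (β : Fin N → ℂ) (κ : ℂ) (L₀ : Matrix (Fin N) (Fin N) ℂ),
    β ⬝ᵥ α = 0 ∧ L₀ *ᵥ α = κ • α ∧
    IsMatOPow (fun w => F w - (w⁻¹ • Matrix.vecMulVec α β + L₀)) 1

/-- Behaviour of a Lax operator at a weak singularity for `so(n)`. -/
def SOWeak (α : Fin N → ℂ) (F : ℂ → Matrix (Fin N) (Fin N) ℂ) : Prop :=
  ∃ (β : Fin N → ℂ) (κ : ℂ) (L₀ : Matrix (Fin N) (Fin N) ℂ),
    β ⬝ᵥ α = 0 ∧ L₀ *ᵥ α = κ • α ∧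
    IsMatOPow (fun w =>
      F w - (w⁻¹ • (Matrix.vecMulVec α β - Matrix.vecMulVec β α) + L₀)) 1

/-- Behaviour of a Lax operator at a weak singularity for `sp(2n)`. -/
def SPWeak (σ : Matrix (Fin N) (Fin N) ℂ) (α : Fin N → ℂ)
    (F : ℂ → Matrix (Fin N) (Fin N) ℂ) : Prop :=
  ∃ (β : Fin N → ℂ) (ν κ : ℂ) (L₀ L₁ : Matrix (Fin N) (Fin N) ℂ),
    β ⬝ᵥ (σ *ᵥ α) = 0 ∧ L₀ *ᵥ α = κ • α ∧ α ⬝ᵥ ((σ * L₁) *ᵥ α) = 0 ∧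
    IsMatOPow (fun w =>
      F w - ((w ^ 2)⁻¹ • (ν • (Matrix.vecMulVec α α * σ))
        + w⁻¹ • ((Matrix.vecMulVec α β + Matrix.vecMulVec β α) * σ) + L₀ + w • L₁)) 2

/-- Behaviour of a connection form at a weak singularity with `α ≠ 0` for `gl(n)`. -/
def GLConn (α : Fin N → ℂ) (F : ℂ → Matrix (Fin N) (Fin N) ℂ) : Prop :=
  ∃ (β : Fin N → ℂ) (κ : ℂ) (ω₀ : Matrix (Fin N) (Fin N) ℂ),
    β ⬝ᵥ α = 1 ∧ ω₀ *ᵥ α = κ • α ∧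
    IsMatOPow (fun w => F w - (w⁻¹ • Matrix.vecMulVec α β + ω₀)) 1

/-- Behaviour of a connection form at a weak singularity with `α ≠ 0` for `so(n)`. -/
def SOConn (α : Fin N → ℂ) (F : ℂ → Matrix (Fin N) (Fin N) ℂ) : Prop :=
  ∃ (β : Fin N → ℂ) (κ : ℂ) (ω₀ : Matrix (Fin N) (Fin N) ℂ),
    β ⬝ᵥ α = 1 ∧ ω₀ *ᵥ α = κ • α ∧
    IsMatOPow (fun w =>
      F w - (w⁻¹ • (Matrix.vecMulVec α β - Matrix.vecMulVec β α) + ω₀)) 1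

/-- Behaviour of a connection form at a weak singularity with `α ≠ 0` for `sp(2n)`. -/
def SPConn (σ : Matrix (Fin N) (Fin N) ℂ) (α : Fin N → ℂ)
    (F : ℂ → Matrix (Fin N) (Fin N) ℂ) : Prop :=
  ∃ (β : Fin N → ℂ) (κ : ℂ) (ω₀ ω₁ : Matrix (Fin N) (Fin N) ℂ),
    β ⬝ᵥ (σ *ᵥ α) = 1 ∧ ω₀ *ᵥ α = κ • α ∧ α ⬝ᵥ ((σ * ω₁) *ᵥ α) = 0 ∧
    IsMatOPow (fun w =>
      F w - (w⁻¹ • ((Matrix.vecMulVec α β + Matrix.vecMulVec β α) * σ) + ω₀ + w • ω₁)) 2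

end Expansions

namespace MatAlg

/-- The condition on a Lax operator, written as a function of the local coordinate, at a weak
singularity with Tyurin parameter `α`. -/
def WeakCond : {n N : ℕ} → MatAlg n N → (Fin N → ℂ) →
    (ℂ → Matrix (Fin N) (Fin N) ℂ) → Prop
  | _, _, gl _, α, F => GLWeak α F
  | _, _, sl _, α, F => GLWeak α F
  | _, _, so _, α, F => SOWeak α F
  | _, _, s _, α, F => GLWeak α F
  | _, _, sp _ σ _ _, α, F => SPWeak σ α F

/-- The condition on the coefficient matrix of a connection form at a weak singularity with
Tyurin parameter `α ≠ 0`. -/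
def ConnCond : {n N : ℕ} → MatAlg n N → (Fin N → ℂ) →
    (ℂ → Matrix (Fin N) (Fin N) ℂ) → Prop
  | _, _, gl _, α, F => GLConn α F
  | _, _, sl _, α, F => GLConn α F
  | _, _, so _, α, F => SOConn α F
  | _, _, s _, α, F => GLConn α F
  | _, _, sp _ σ _ _, α, F => SPConn σ α F

end MatAlg

section Closure

variable {N : ℕ} {α : Fin N → ℂ} {σ : Matrix (Fin N) (Fin N) ℂ}
  {F G : ℂ → Matrix (Fin N) (Fin N) ℂ}

theorem GLWeak.zero : GLWeak α (fun _ => 0) :=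
  ⟨0, 0, 0, by simp, by simp, by simpa using IsMatOPow.zero 1⟩

theorem GLWeak.add (hF : GLWeak α F) (hG : GLWeak α G) : GLWeak α (fun w => F w + G w) := by
  obtain ⟨β, κ, A, h1, h2, h3⟩ := hF
  obtain ⟨β', κ', A', h1', h2', h3'⟩ := hG
  refine ⟨β + β', κ + κ', A + A', by simp [h1, h1'],
    by rw [Matrix.add_mulVec, h2, h2', add_smul], ?_⟩
  convert h3.add h3' using 2 with w
  rw [Matrix.vecMulVec_add]
  module

theorem GLWeak.smul (c : ℂ) (hF : GLWeak α F) : GLWeak α (fun w => c • F w) := by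
  obtain ⟨β, κ, A, h1, h2, h3⟩ := hF
  refine ⟨c • β, c * κ, c • A, by simp [h1], by rw [Matrix.smul_mulVec, h2, smul_smul], ?_⟩
  convert h3.smul c using 2 with w
  rw [Matrix.vecMulVec_smul, smul_comm, smul_sub, smul_add]

theorem SOWeak.zero : SOWeak α (fun _ => 0) :=
  ⟨0, 0, 0, by simp, by simp, by simpa using IsMatOPow.zero 1⟩

theorem SOWeak.add (hF : SOWeak α F) (hG : SOWeak α G) : SOWeak α (fun w => F w + G w) := by
  obtain ⟨β, κ, A, h1, h2, h3⟩ := hF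
  obtain ⟨β', κ', A', h1', h2', h3'⟩ := hG
  refine ⟨β + β', κ + κ', A + A', by simp [h1, h1'],
    by rw [Matrix.add_mulVec, h2, h2', add_smul], ?_⟩
  convert h3.add h3' using 2 with w
  rw [Matrix.vecMulVec_add, Matrix.add_vecMulVec]
  module

theorem SOWeak.smul (c : ℂ) (hF : SOWeak α F) : SOWeak α (fun w => c • F w) := by
  obtain ⟨β, κ, A, h1, h2, h3⟩ := hF
  refine ⟨c • β, c * κ, c • A, by simp [h1], by rw [Matrix.smul_mulVec, h2, smul_smul], ?_⟩
  convert h3.smul c using 2 with w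
  rw [Matrix.vecMulVec_smul, Matrix.smul_vecMulVec]
  module

theorem SPWeak.zero : SPWeak σ α (fun _ => 0) :=
  ⟨0, 0, 0, 0, 0, by simp, by simp, by simp, by simpa using IsMatOPow.zero 2⟩

theorem SPWeak.add (hF : SPWeak σ α F) (hG : SPWeak σ α G) :
    SPWeak σ α (fun w => F w + G w) := by
  obtain ⟨β, ν, κ, A, B, h1, h2, h3, h4⟩ := hF
  obtain ⟨β', ν', κ', A', B', h1', h2', h3', h4'⟩ := hG
  refine ⟨β + β', ν + ν', κ + κ', A + A', B + B', by simp [h1, h1'],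
    by rw [Matrix.add_mulVec, h2, h2', add_smul],
    by rw [mul_add, Matrix.add_mulVec, dotProduct_add, h3, h3', add_zero], ?_⟩
  convert h4.add h4' using 2 with w
  simp only [Matrix.vecMulVec_add, Matrix.add_vecMulVec, add_mul]
  module

theorem SPWeak.smul (c : ℂ) (hF : SPWeak σ α F) : SPWeak σ α (fun w => c • F w) := by
  obtain ⟨β, ν, κ, A, B, h1, h2, h3, h4⟩ := hF
  refine ⟨c • β, c * ν, c * κ, c • A, c • B, by simp [h1],
    by rw [Matrix.smul_mulVec, h2, smul_smul],
    by rw [Matrix.mul_smul, Matrix.smul_mulVec, dotProduct_smul, h3, smul_zero], ?_⟩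
  convert h4.smul c using 2 with w
  simp only [Matrix.vecMulVec_smul, Matrix.smul_vecMulVec, add_mul, Matrix.smul_mul]
  module

theorem MatAlg.WeakCond.zero {n N : ℕ} (A : MatAlg n N) (α : Fin N → ℂ) :
    A.WeakCond α (fun _ => 0) := by
  cases A
  · exact GLWeak.zero
  · exact GLWeak.zero
  · exact SOWeak.zero
  · exact GLWeak.zero
  · exact SPWeak.zero

theorem MatAlg.WeakCond.add {n N : ℕ} {A : MatAlg n N} {α : Fin N → ℂ}
    {F G : ℂ → Matrix (Fin N) (Fin N) ℂ} (hF : A.WeakCond α F) (hG : A.WeakCond α G) :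
    A.WeakCond α (fun w => F w + G w) := by
  cases A
  · exact GLWeak.add hF hG
  · exact GLWeak.add hF hG
  · exact SOWeak.add hF hG
  · exact GLWeak.add hF hG
  · exact SPWeak.add hF hG

theorem MatAlg.WeakCond.smul {n N : ℕ} {A : MatAlg n N} {α : Fin N → ℂ}
    {F : ℂ → Matrix (Fin N) (Fin N) ℂ} (c : ℂ) (hF : A.WeakCond α F) :
    A.WeakCond α (fun w => c • F w) := by
  cases A
  · exact GLWeak.smul c hF
  · exact GLWeak.smul c hF
  · exact SOWeak.smul c hF
  · exact GLWeak.smul c hF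
  · exact SPWeak.smul c hF

end Closure

/-! ### Lax operator algebras -/

/-- Two distinct marked points `P₊`, `P₋`, Tyurin data `(γ_s, α_s)`, `s = 1, …, n g`, and fixed
local coordinates at all these points. -/
structure LaxData (X : Type*) [TopologicalSpace X] [ChartedSpace ℂ X] {n N : ℕ}
    (A : MatAlg n N) where
  Pp : X
  Pm : X
  Pp_ne_Pm : Pp ≠ Pm
  pt : Fin (n * genus X) → X
  pt_injective : Function.Injective pt
  pt_ne_Pp : ∀ s, pt s ≠ Pp
  pt_ne_Pm : ∀ s, pt s ≠ Pm
  vec : Fin (n * genus X) → Fin N → ℂ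
  vec_admissible : ∀ s, A.Admissible (vec s)
  zp : OpenPartialHomeomorph X ℂ
  zm : OpenPartialHomeomorph X ℂ
  z : Fin (n * genus X) → OpenPartialHomeomorph X ℂ
  zp_coord : IsCoord zp Pp
  zm_coord : IsCoord zm Pm
  z_coord : ∀ s, IsCoord (z s) (pt s)

variable {X : Type*} [TopologicalSpace X] [ChartedSpace ℂ X] {n N : ℕ} {A : MatAlg n N}

namespace LaxData

variable (D : LaxData X A)

/-- The set `W ∪ {P₊, P₋}`. -/
def marked : Set X := Set.range D.pt ∪ {D.Pp, D.Pm}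

/-- The Lax operator algebra.  A meromorphic function which is holomorphic outside
`W ∪ {P₊, P₋}` is represented by the honest function that agrees with it outside
`W ∪ {P₊, P₋}` and is set to `0` on this finite set, so that equal meromorphic functions
have equal representatives. -/
def laxAlgebra : Submodule ℂ (X → Matrix (Fin N) (Fin N) ℂ) where
  carrier := {L |
    (∀ x ∈ D.marked, L x = 0) ∧
    (∀ x, L x ∈ A.carrier) ∧
    (∀ x ∉ D.marked, ∀ i j, MDifferentiableAt 𝓘(ℂ) 𝓘(ℂ) (fun y => L y i j) x) ∧
    (∀ i j, MeromorphicAt (fun w => L (D.zp.symm w) i j) 0) ∧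
    (∀ i j, MeromorphicAt (fun w => L (D.zm.symm w) i j) 0) ∧
    (∀ s, A.WeakCond (D.vec s) (fun w => L ((D.z s).symm w)))}
  zero_mem' := ⟨fun _ _ => rfl, fun _ => zero_mem _, fun _ _ _ _ => mdifferentiableAt_const,
    fun _ _ => MeromorphicAt.const 0 0, fun _ _ => MeromorphicAt.const 0 0,
    fun _ => MatAlg.WeakCond.zero A _⟩
  add_mem' := fun {a b} ha hb =>
    ⟨fun x hx => by simp [ha.1 x hx, hb.1 x hx],
      fun x => add_mem (ha.2.1 x) (hb.2.1 x),
      fun x hx i j => (ha.2.2.1 x hx i j).add (hb.2.2.1 x hx i j),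
      fun i j => (ha.2.2.2.1 i j).add (hb.2.2.2.1 i j),
      fun i j => (ha.2.2.2.2.1 i j).add (hb.2.2.2.2.1 i j),
      fun s => (ha.2.2.2.2.2 s).add (hb.2.2.2.2.2 s)⟩
  smul_mem' := fun c a ha =>
    ⟨fun x hx => by simp [ha.1 x hx],
      fun x => Submodule.smul_mem _ c (ha.2.1 x),
      fun x hx i j => (ha.2.2.1 x hx i j).const_smul c,
      fun i j => (MeromorphicAt.const c 0).mul (ha.2.2.2.1 i j),
      fun i j => (MeromorphicAt.const c 0).mul (ha.2.2.2.2.1 i j),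
      fun s => (ha.2.2.2.2.2 s).smul c⟩

/-- The Krichever--Novikov function algebra: meromorphic functions on `X`, holomorphic outside
`{P₊, P₋}` (and represented by functions which are `0` at `P₊` and `P₋`). -/
def functionAlgebra : Submodule ℂ (X → ℂ) where
  carrier := {f |
    (f D.Pp = 0 ∧ f D.Pm = 0) ∧
    (∀ x, x ≠ D.Pp → x ≠ D.Pm → MDifferentiableAt 𝓘(ℂ) 𝓘(ℂ) f x) ∧
    MeromorphicAt (fun w => f (D.zp.symm w)) 0 ∧
    MeromorphicAt (fun w => f (D.zm.symm w)) 0}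
  zero_mem' := ⟨⟨rfl, rfl⟩, fun _ _ _ => mdifferentiableAt_const,
    MeromorphicAt.const 0 0, MeromorphicAt.const 0 0⟩
  add_mem' := fun {a b} ha hb =>
    ⟨⟨by simp [ha.1.1, hb.1.1], by simp [ha.1.2, hb.1.2]⟩,
      fun x h h' => (ha.2.1 x h h').add (hb.2.1 x h h'),
      ha.2.2.1.add hb.2.2.1, ha.2.2.2.add hb.2.2.2⟩
  smul_mem' := fun c a ha =>
    ⟨⟨by simp [ha.1.1], by simp [ha.1.2]⟩,
      fun x h h' => (ha.2.1 x h h').const_smul c,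
      (MeromorphicAt.const c 0).mul ha.2.2.1, (MeromorphicAt.const c 0).mul ha.2.2.2⟩

/-- The Krichever--Novikov vector fields: meromorphic vector fields on `X`, holomorphic outside
`{P₊, P₋}`. -/
def IsKNField (e : VField X) : Prop :=
  (∀ x, x ≠ D.Pp → x ≠ D.Pm → HoloFieldAt e x) ∧
  MeromorphicAt (fieldCoeff D.zp e) 0 ∧ MeromorphicAt (fieldCoeff D.zm e) 0

/-! ### Connections -/

end LaxData

/-- Matrix valued one-forms. -/
abbrev MatForm (X : Type*) [TopologicalSpace X] [ChartedSpace ℂ X] (N : ℕ) : Type _ :=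
  (x : X) → (TangentSpace 𝓘(ℂ) x →ₗ[ℂ] Matrix (Fin N) (Fin N) ℂ)

/-- The matrix function `F` with `θ = F dz` in the coordinate `z`. -/
def matCoeff (z : OpenPartialHomeomorph X ℂ) (θ : MatForm X N) :
    ℂ → Matrix (Fin N) (Fin N) ℂ :=
  fun w => θ (z.symm w) (coordVec z w)

namespace LaxData

variable (D : LaxData X A)

/-- Connection forms: meromorphic matrix valued one-forms, holomorphic outside
`W ∪ {P₊, P₋}`, regular at the `γ_s` with `α_s = 0`, and with the prescribed expansion at the
`γ_s` with `α_s ≠ 0`. -/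
structure IsConnectionForm (θ : MatForm X N) : Prop where
  mem : ∀ x v, θ x v ∈ A.connCarrier
  holo : ∀ x ∉ D.marked, ∀ i j, DifferentiableAt ℂ
    (fun w => matCoeff (chartAt ℂ x) θ w i j) (chartAt ℂ x x)
  mero_Pp : ∀ i j, MeromorphicAt (fun w => matCoeff D.zp θ w i j) 0
  mero_Pm : ∀ i j, MeromorphicAt (fun w => matCoeff D.zm θ w i j) 0
  regular : ∀ s, D.vec s = 0 → IsMatOPow (matCoeff (D.z s) θ) 0
  weak : ∀ s, D.vec s ≠ 0 → A.ConnCond (D.vec s) (matCoeff (D.z s) θ)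

open Classical in
/-- The covariant derivative `∇_e L = e.L + [θ(e), L]` (again set to `0` on `W ∪ {P₊, P₋}`). -/
def nabla (θ : MatForm X N) (e : VField X) (L : X → Matrix (Fin N) (Fin N) ℂ) :
    X → Matrix (Fin N) (Fin N) ℂ :=
  fun x => if x ∈ D.marked then 0 else
    Matrix.of (fun i j => dfun (fun y => L y i j) x (e x)) + ⁅θ x (e x), L x⁆

end LaxData

/-! ### The cocycle -/

/-- The differential `tr(L) · tr(dL')`. -/
def traceForm (L L' : X → Matrix (Fin N) (Fin N) ℂ) : OneForm X :=
  fun x => (L x).trace • ∑ i, dfun (fun y => L' y i i) x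

namespace LaxData

variable (D : LaxData X A)

/-- `γ₂(L, L') = res_{P₊} (tr(L) · tr(dL'))`. -/
def gammaTwo (L L' : X → Matrix (Fin N) (Fin N) ℂ) : ℂ :=
  residueAtZero (formCoeff D.zp (traceForm L L'))

end LaxData

/-- `γ` is a Lie algebra two-cocycle on the space `V` of matrix valued functions with the
pointwise commutator as bracket. -/
structure IsTwoCocycleOn (V : Submodule ℂ (X → Matrix (Fin N) (Fin N) ℂ))
    (γ : (X → Matrix (Fin N) (Fin N) ℂ) → (X → Matrix (Fin N) (Fin N) ℂ) → ℂ) : Prop where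
  add_left : ∀ L ∈ V, ∀ M ∈ V, ∀ L' ∈ V, γ (L + M) L' = γ L L' + γ M L'
  add_right : ∀ L ∈ V, ∀ L' ∈ V, ∀ M ∈ V, γ L (L' + M) = γ L L' + γ L M
  smul_left : ∀ c : ℂ, ∀ L ∈ V, ∀ L' ∈ V, γ (c • L) L' = c * γ L L'
  smul_right : ∀ c : ℂ, ∀ L ∈ V, ∀ L' ∈ V, γ L (c • L') = c * γ L L'
  antisymm : ∀ L ∈ V, ∀ L' ∈ V, γ L L' = -γ L' L
  jacobi : ∀ L ∈ V, ∀ L' ∈ V, ∀ L'' ∈ V,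
    γ (fun x => ⁅L x, L' x⁆) L'' + γ (fun x => ⁅L' x, L'' x⁆) L
      + γ (fun x => ⁅L'' x, L x⁆) L' = 0

namespace LaxData

variable (D : LaxData X A)

/-- Invariance of a bilinear form under all Krichever--Novikov vector fields, acting through the
covariant derivative of the connection form `θ`. -/
def IsInvariant (θ : MatForm X N)
    (γ : (X → Matrix (Fin N) (Fin N) ℂ) → (X → Matrix (Fin N) (Fin N) ℂ) → ℂ) : Prop :=
  ∀ e : VField X, D.IsKNField e → ∀ L ∈ D.laxAlgebra, ∀ L' ∈ D.laxAlgebra,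
    γ (D.nabla θ e L) L' + γ L (D.nabla θ e L') = 0

/-! ### The almost-grading -/

/-- A Krichever--Novikov basis of the function algebra: a basis `(A_m)`, `m ∈ ℤ`, with
`A_m = z₊^m + O(z₊^(m+1))` at `P₊` and complementary order at `P₋`, up to a constant which does
not depend on `m` (`c = g` for generic `m` and generic `P₊`, `P₋`). -/
structure IsKNBasis (a : ℤ → X → ℂ) : Prop where
  mem : ∀ m, a m ∈ D.functionAlgebra
  linearIndependent : LinearIndependent ℂ a
  span_eq : Submodule.span ℂ (Set.range a) = D.functionAlgebra
  order_Pp : ∀ m, IsOPow (fun w => a m (D.zp.symm w) - w ^ m) (m + 1)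
  order_Pm : ∃ c : ℤ, ∀ m, IsOPow (fun w => a m (D.zm.symm w)) (-m - c)

open Classical in
/-- The linear map `Y ↦ f · Y` on constant matrices, for a fixed scalar function `f`. -/
def currentMap (f : X → ℂ) :
    Matrix (Fin N) (Fin N) ℂ →ₗ[ℂ] (X → Matrix (Fin N) (Fin N) ℂ) where
  toFun := fun Y x => if x ∈ D.marked then 0 else f x • Y
  map_add' := fun Y Z => by
    funext x
    by_cases h : x ∈ D.marked <;> simp [h]
  map_smul' := fun c Y => by
    funext x
    by_cases h : x ∈ D.marked
    · simp [h]
    · simp only [h, if_false, Pi.smul_apply, RingHom.id_apply]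
      exact smul_comm (f x) c Y

/-- The functions `f · Y` for a fixed scalar function `f` and a constant matrix `Y ∈ V`. -/
def currents (V : Submodule ℂ (Matrix (Fin N) (Fin N) ℂ)) (f : X → ℂ) :
    Submodule ℂ (X → Matrix (Fin N) (Fin N) ℂ) :=
  V.map (D.currentMap f)

/-- The space of `V`-valued Lax operators `L` with
`L = Y₊ z₊^m + O(z₊^(m+1))` and `L = Y₋ z₋^(-m-g) + O(z₋^(-m-g+1))`, where `Y₊, Y₋ ∈ V`. -/
def orderSpace (V : Submodule ℂ (Matrix (Fin N) (Fin N) ℂ)) (m : ℤ) :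
    Submodule ℂ (X → Matrix (Fin N) (Fin N) ℂ) where
  carrier := {L | L ∈ D.laxAlgebra ∧ (∀ x, L x ∈ V) ∧
    (∃ Y ∈ V, IsMatOPow (fun w => L (D.zp.symm w) - w ^ m • Y) (m + 1)) ∧
    (∃ Y ∈ V, IsMatOPow (fun w => L (D.zm.symm w) - w ^ (-m - (genus X : ℤ)) • Y)
      (-m - (genus X : ℤ) + 1))}
  zero_mem' := ⟨zero_mem _, fun _ => zero_mem _,
    ⟨0, zero_mem _, by simpa using IsMatOPow.zero _⟩,
    ⟨0, zero_mem _, by simpa using IsMatOPow.zero _⟩⟩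
  add_mem' := by
    rintro L M ⟨h1, h2, ⟨Y, hY, h3⟩, ⟨Z, hZ, h4⟩⟩ ⟨h1', h2', ⟨Y', hY', h3'⟩, ⟨Z', hZ', h4'⟩⟩
    refine ⟨add_mem h1 h1', fun x => add_mem (h2 x) (h2' x), ⟨Y + Y', add_mem hY hY', ?_⟩,
      ⟨Z + Z', add_mem hZ hZ', ?_⟩⟩
    · convert h3.add h3' using 2 with w
      simp only [Pi.add_apply]
      module
    · convert h4.add h4' using 2 with w
      simp only [Pi.add_apply]
      module
  smul_mem' := by
    rintro c L ⟨h1, h2, ⟨Y, hY, h3⟩, ⟨Z, hZ, h4⟩⟩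
    refine ⟨Submodule.smul_mem _ c h1, fun x => Submodule.smul_mem _ c (h2 x),
      ⟨c • Y, Submodule.smul_mem _ c hY, ?_⟩, ⟨c • Z, Submodule.smul_mem _ c hZ, ?_⟩⟩
    · convert h3.smul c using 2 with w
      simp only [Pi.smul_apply]
      module
    · convert h4.smul c using 2 with w
      simp only [Pi.smul_apply]
      module

open Classical in
/-- The homogeneous subspace of degree `m`.  If all Tyurin vectors vanish, it consists of the
functions `a_m · Y`.  Otherwise it is given by the orders at `P₊` and `P₋`, except that for
`-g ≤ m ≤ 0` the scalar matrices (which occur for `gl(n)` and `s(n)` only) are graded by the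
basis `(a_m)`. -/
def homogeneous (a : ℤ → X → ℂ) (m : ℤ) : Submodule ℂ (X → Matrix (Fin N) (Fin N) ℂ) :=
  if ∀ s, D.vec s = 0 then D.currents A.carrier (a m)
  else if 1 ≤ m ∨ m ≤ -(genus X : ℤ) - 1 then D.orderSpace A.carrier m
  else D.orderSpace A.tracelessPart m ⊔ D.currents A.scalarPart (a m)

/-- Families of subspaces of the Lax operator algebra whose elements of degree `m` have order at
least `m` at `P₊` and at least `-m - c` at `P₋`, with `c` independent of `m`.  The almost-gradings
used for points in special position, where the order requirement at `P₋` is adapted, are of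
this kind. -/
def IsOrderFamily (G : ℤ → Submodule ℂ (X → Matrix (Fin N) (Fin N) ℂ)) : Prop :=
  (∀ m, G m ≤ D.laxAlgebra) ∧
  ∃ c : ℤ, ∀ m, ∀ L ∈ G m,
    IsMatOPow (fun w => L (D.zp.symm w)) m ∧ IsMatOPow (fun w => L (D.zm.symm w)) (-m - c)

end LaxData

/-- Locality with respect to a family of homogeneous subspaces. -/
def IsLocal (G : ℤ → Submodule ℂ (X → Matrix (Fin N) (Fin N) ℂ))
    (γ : (X → Matrix (Fin N) (Fin N) ℂ) → (X → Matrix (Fin N) (Fin N) ℂ) → ℂ) : Prop :=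
  ∃ R S : ℤ, ∀ k m : ℤ, ∀ L ∈ G k, ∀ L' ∈ G m, γ L L' ≠ 0 → R ≤ k + m ∧ k + m ≤ S

end LaxOperator

end

/-! Everything passes through traces. For `gl`, `sl`, `s` the residue αβᵗ at a weak singularity has
trace βᵗα = 0; for `so` and `sp` the trace vanishes identically. So tr L is bounded near each γ_s
and extends to a function f holomorphic off P₊, P₋ (`TraceRegular.exists_extension`), and γ₂(L, L')
is the residue of f df' at P₊ (`TraceRegular.gammaTwo_eq`).

Antisymmetry says that d(ff') has no residue. Commutators are traceless, so each term of the cocycle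
identity vanishes by itself. For the same reason tr(∇_e L) = e.(tr L); writing e = v d/dz and F, G
for the traces in the coordinate z, the invariance identity asks for the residue of vF'G' + F(vG')'
= (F·vG')', which is zero.

Locality uses both marked points. At P₊ the traces have orders at least k and m, so f df' is regular
there once k + m ≥ 1. At P₋ the orders add up to at least -(k + m) - 2c, so f df' is regular there
once k + m < -2c, and the residue theorem carries this vanishing over to P₊.

The residue theorem for f dh (`sum_residueAtZero_diffCoeff_eq_zero`) comes from Stokes. Take a
finite real-C¹ partition of unity φ_i, each φ_i supported in a coordinate domain and locally
constant near the singular points. Then ∑ ∫ ∂̄φ_i ∧ f dh = ∫ ∂̄1 ∧ f dh = 0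
(`sum_integral_dbarCoeff_eq_zero`). A φ_i vanishing near the singular points contributes 0
(`integral_dbarCoeff_eq_zero`), and a radial bump at a singular point contributes -2π times the
residue (`integral_dbar_radialCutoff_mul`). -/

namespace LaxOperator

/-! ### The Wirtinger derivative -/

/-- Twice the Wirtinger derivative `∂g/∂w̄`. -/
noncomputable def dbar (g : ℂ → ℂ) (w : ℂ) : ℂ :=
  fderiv ℝ g w 1 + Complex.I * fderiv ℝ g w Complex.I

theorem dbar_congr {g h : ℂ → ℂ} {w : ℂ} (H : g =ᶠ[𝓝 w] h) : dbar g w = dbar h w := by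
  simp only [dbar, H.fderiv_eq]

theorem dbar_const (c w : ℂ) : dbar (fun _ => c) w = 0 := by
  simp [dbar]

theorem real_fderiv_eq_deriv_mul {g : ℂ → ℂ} {w : ℂ} (hg : DifferentiableAt ℂ g w) (v : ℂ) :
    fderiv ℝ g w v = deriv g w * v := by
  rw [(hg.hasDerivAt.hasFDerivAt.restrictScalars ℝ).fderiv]
  simp [mul_comm]

theorem dbar_eq_zero {g : ℂ → ℂ} {w : ℂ} (hg : DifferentiableAt ℂ g w) : dbar g w = 0 := by
  rw [dbar, real_fderiv_eq_deriv_mul hg, real_fderiv_eq_deriv_mul hg]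
  linear_combination deriv g w * Complex.I_mul_I

theorem dbar_mul {g h : ℂ → ℂ} {w : ℂ} (hg : DifferentiableAt ℝ g w)
    (hh : DifferentiableAt ℝ h w) :
    dbar (fun x => g x * h x) w = dbar g w * h w + g w * dbar h w := by
  simp only [dbar, fderiv_fun_mul hg hh, add_apply, smul_apply,
    smul_eq_mul]
  ring

theorem dbar_sum {ι : Type*} (s : Finset ι) {g : ι → ℂ → ℂ} {w : ℂ}
    (hg : ∀ i ∈ s, DifferentiableAt ℝ (g i) w) :
    dbar (fun x => ∑ i ∈ s, g i x) w = ∑ i ∈ s, dbar (g i) w := by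
  simp only [dbar, fderiv_fun_sum hg, sum_apply, Finset.mul_sum,
    Finset.sum_add_distrib]

/-- The real differential of ψ is multiplication by ψ', so the conjugate-linear part of dg picks up
the conjugate of ψ'. -/
theorem dbar_comp {g ψ : ℂ → ℂ} {w : ℂ} (hg : DifferentiableAt ℝ g (ψ w))
    (hψ : DifferentiableAt ℂ ψ w) :
    dbar (g ∘ ψ) w = dbar g (ψ w) * starRingEnd ℂ (deriv ψ w) := by
  have h : ∀ a : ℂ, fderiv ℝ g (ψ w) a
      = a.re * fderiv ℝ g (ψ w) 1 + a.im * fderiv ℝ g (ψ w) Complex.I := by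
    intro a
    conv_lhs => rw [show a = a.re • (1 : ℂ) + a.im • Complex.I by simp]
    rw [map_add, map_smul, map_smul]
    simp
  have h1 : ∀ v, fderiv ℝ (g ∘ ψ) w v = fderiv ℝ g (ψ w) (deriv ψ w * v) := by
    intro v
    rw [fderiv_comp w hg (hψ.restrictScalars ℝ), ContinuousLinearMap.comp_apply,
      real_fderiv_eq_deriv_mul hψ]
  have e : starRingEnd ℂ (deriv ψ w) = (deriv ψ w).re - (deriv ψ w).im * Complex.I :=
    Complex.ext (by simp) (by simp)
  simp only [dbar, h1]
  rw [h, h (deriv ψ w * Complex.I), e]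
  simp only [mul_one, Complex.mul_re, Complex.I_re, mul_zero, Complex.I_im, zero_sub,
    Complex.mul_im, add_zero, Complex.ofReal_neg]
  linear_combination ((deriv ψ w).im * fderiv ℝ g (ψ w) Complex.I) * Complex.I_mul_I

theorem continuousAt_dbar {g : ℂ → ℂ} {w : ℂ} (hg : ContDiffAt ℝ 1 g w) :
    ContinuousAt (dbar g) w := by
  have h : ContinuousAt (fderiv ℝ g) w := hg.continuousAt_fderiv (by simp)
  exact (h.clm_apply continuousAt_const).add
    (continuousAt_const.mul (h.clm_apply continuousAt_const))

/-- Integration by parts against the constant function 1. -/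
theorem integral_fderiv_eq_zero {G : ℂ → ℂ} (hG : ContDiff ℝ 1 G) (hc : HasCompactSupport G)
    (v : ℂ) : ∫ w, fderiv ℝ G w v = 0 := by
  have hi : MeasureTheory.Integrable (fun w => fderiv ℝ G w v) :=
    ((hG.continuous_fderiv (by simp)).clm_apply continuous_const).integrable_of_hasCompactSupport
      (hc.fderiv_apply (𝕜 := ℝ) v)
  have := integral_mul_fderiv_eq_neg_fderiv_mul_of_integrable (μ := MeasureTheory.volume)
    (f := fun _ : ℂ => (1 : ℂ)) (g := G) (v := v) (by simp) (by simpa using hi)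
    (by simpa using hG.continuous.integrable_of_hasCompactSupport hc)
    (fun _ _ => differentiableAt_const _) (fun x _ => hG.differentiable (by simp) x)
  simpa using this

theorem integral_dbar_eq_zero {G : ℂ → ℂ} (hG : ContDiff ℝ 1 G) (hc : HasCompactSupport G) :
    ∫ w, dbar G w = 0 := by
  have hi : ∀ v, MeasureTheory.Integrable (fun w => fderiv ℝ G w v) := fun v =>
    ((hG.continuous_fderiv (by simp)).clm_apply continuous_const).integrable_of_hasCompactSupport
      (hc.fderiv_apply (𝕜 := ℝ) v)
  simp only [dbar]
  rw [MeasureTheory.integral_add (hi _) ((hi _).const_mul _), MeasureTheory.integral_const_mul,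
    integral_fderiv_eq_zero hG hc, integral_fderiv_eq_zero hG hc]
  simp

/-- The real Jacobian of a holomorphic map is |ψ'|². It is kept as ψ' times its conjugate because f
dh transforms by the first factor and ∂̄φ by the second. -/
theorem integral_image_holomorphic {s : Set ℂ} (hs : IsOpen s) {ψ : ℂ → ℂ}
    (hψ : DifferentiableOn ℂ ψ s) (hi : Set.InjOn ψ s) (F : ℂ → ℂ) :
    ∫ w in ψ '' s, F w
      = ∫ w in s, (deriv ψ w * starRingEnd ℂ (deriv ψ w)) * F (ψ w) := by
  have hd : ∀ w ∈ s, HasFDerivWithinAt ψ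
      ((ContinuousLinearMap.toSpanSingleton ℂ (deriv ψ w)).restrictScalars ℝ) s w := fun w hw =>
    (((hψ w hw).differentiableAt (hs.mem_nhds hw)).hasDerivAt.hasFDerivAt.restrictScalars
      ℝ).hasFDerivWithinAt
  rw [MeasureTheory.integral_image_eq_integral_abs_det_fderiv_smul _ hs.measurableSet hd hi]
  refine MeasureTheory.setIntegral_congr_fun hs.measurableSet fun w _ => ?_
  have : ((ContinuousLinearMap.toSpanSingleton ℂ (deriv ψ w)).restrictScalars ℝ).det
      = Complex.normSq (deriv ψ w) := by
    simp [ContinuousLinearMap.det, LinearMap.det_restrictScalars, Algebra.norm_complex_eq]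
  simp only [this, abs_of_nonneg (Complex.normSq_nonneg _), Complex.real_smul, Complex.mul_conj]

/-! ### Radial cut-off functions -/

/-- The radial cut-off function which is `1` for `|w|² ≤ a` and `0` for `|w|² ≥ b`. -/
noncomputable def radialCutoff (a b : ℝ) (w : ℂ) : ℂ :=
  (Real.smoothTransition ((b - Complex.normSq w) / (b - a)) : ℝ)

theorem contDiff_normSq : ContDiff ℝ ∞ (fun w : ℂ => Complex.normSq w) := by
  simp only [Complex.normSq_apply]
  exact (Complex.reCLM.contDiff.mul Complex.reCLM.contDiff).add
    (Complex.imCLM.contDiff.mul Complex.imCLM.contDiff)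

theorem contDiff_radialCutoff (a b : ℝ) : ContDiff ℝ 1 (radialCutoff a b) := by
  have h : ContDiff ℝ 1 fun w : ℂ => (b - Complex.normSq w) / (b - a) :=
    (contDiff_const.sub (contDiff_normSq.of_le (by simp))).div_const _
  exact Complex.ofRealCLM.contDiff.comp ((Real.smoothTransition.contDiff (n := 1)).comp h)

theorem radialCutoff_eq_one {a b : ℝ} (hab : a < b) {w : ℂ} (hw : Complex.normSq w ≤ a) :
    radialCutoff a b w = 1 := by
  rw [radialCutoff, Real.smoothTransition.one_of_one_le, Complex.ofReal_one]
  rw [le_div_iff₀ (sub_pos.2 hab)]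
  linarith

theorem radialCutoff_eq_zero {a b : ℝ} (hab : a < b) {w : ℂ} (hw : b ≤ Complex.normSq w) :
    radialCutoff a b w = 0 := by
  rw [radialCutoff, Real.smoothTransition.zero_of_nonpos, Complex.ofReal_zero]
  exact div_nonpos_of_nonpos_of_nonneg (by linarith) (by linarith)

/-- Chain rule with ∂|w|²/∂w̄ = w. The factor w is what turns the angular integral in polar
coordinates into a circle integral. -/
theorem dbar_radialCutoff (a b : ℝ) (w : ℂ) :
    dbar (radialCutoff a b) w
      = 2 * w * (deriv (fun t => Real.smoothTransition ((b - t) / (b - a)))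
          (Complex.normSq w) : ℝ) := by
  set κ : ℝ → ℝ := fun t => Real.smoothTransition ((b - t) / (b - a)) with hκ
  have h1 : DifferentiableAt ℝ κ (Complex.normSq w) :=
    ((Real.smoothTransition.contDiff (n := 1)).differentiable (by simp)).comp
      (by fun_prop : Differentiable ℝ fun t : ℝ => (b - t) / (b - a)) _
  have h2 : HasFDerivAt (fun w : ℂ => Complex.normSq w)
      (w.re • Complex.reCLM + w.re • Complex.reCLM
        + (w.im • Complex.imCLM + w.im • Complex.imCLM)) w := by
    simp only [Complex.normSq_apply]
    exact (Complex.reCLM.hasFDerivAt.mul Complex.reCLM.hasFDerivAt).add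
      (Complex.imCLM.hasFDerivAt.mul Complex.imCLM.hasFDerivAt)
  have h3 := (Complex.ofRealCLM.hasFDerivAt (x := κ (Complex.normSq w))).comp w
    (h1.hasDerivAt.hasFDerivAt.comp w h2)
  have h4 : fderiv ℝ (radialCutoff a b) w = _ := HasFDerivAt.fderiv h3
  rw [dbar, h4]
  simp only [ContinuousLinearMap.comp_apply, ContinuousLinearMap.toSpanSingleton_apply,
    add_apply, smul_apply, Complex.reCLM_apply, Complex.imCLM_apply, Complex.one_re,
    Complex.one_im, Complex.I_re, Complex.I_im, smul_eq_mul, Complex.ofRealCLM_apply]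
  apply Complex.ext <;> simp <;> left <;> ring


/-! ### Polar coordinates: integrating ∂̄ of a cut-off against a function on a punctured disc. -/

/-- The angle is shifted to (-π, π), the range used by `polarCoord`. -/
theorem circleIntegral_eq_integral_symm (c : ℂ → ℂ) (r : ℝ) :
    (∮ w in C(0, r), c w)
      = ∫ θ in Set.Ioo (-Real.pi) Real.pi,
          r * (Real.cos θ + Real.sin θ * Complex.I) * Complex.I *
            c (r * (Real.cos θ + Real.sin θ * Complex.I)) := by
  have hp : Function.Periodic
      (fun θ : ℝ => deriv (circleMap 0 r) θ • c (circleMap 0 r θ)) (2 * Real.pi) := by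
    intro θ
    simp [deriv_circleMap, periodic_circleMap 0 r θ]
  have h := hp.intervalIntegral_add_eq 0 (-Real.pi)
  rw [zero_add] at h
  rw [circleIntegral, h, intervalIntegral.integral_of_le (by linarith [Real.pi_pos]),
    MeasureTheory.integral_Ioc_eq_integral_Ioo,
    show -Real.pi + 2 * Real.pi = Real.pi by ring]
  refine MeasureTheory.setIntegral_congr_fun measurableSet_Ioo fun θ _ => ?_
  simp [circleMap, deriv_circleMap, Complex.exp_mul_I]

/-- The derivative of the cut-off lives on the annulus a ≤ |w|² ≤ b, which avoids 0 and stays inside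
the ball of radius R, so a singularity of c at 0 does no harm. -/
theorem continuous_radial_integrand {a b R : ℝ} (ha : 0 < a) (hab : a < b) (hbR : b < R ^ 2)
    (hR : 0 < R) {c : ℂ → ℂ} (hc : ContinuousOn c (Metric.ball 0 R \ {0})) :
    Continuous fun w => dbar (radialCutoff a b) w * c w := by
  rw [continuous_iff_continuousAt]
  intro w
  by_cases h0 : Complex.normSq w < a
  · have : (fun w => dbar (radialCutoff a b) w * c w) =ᶠ[𝓝 w] fun _ => 0 := by
      have hn : {w | Complex.normSq w < a} ∈ 𝓝 w :=
        (isOpen_lt Complex.continuous_normSq continuous_const).mem_nhds h0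
      filter_upwards [eventually_mem_nhds_iff.2 hn] with v hv
      rw [dbar_congr (h := fun _ => 1) (by
        filter_upwards [hv] with u hu using radialCutoff_eq_one hab hu.le), dbar_const, zero_mul]
    exact this.continuousAt
  by_cases h1 : b < Complex.normSq w
  · have : (fun w => dbar (radialCutoff a b) w * c w) =ᶠ[𝓝 w] fun _ => 0 := by
      have hn : {w | b < Complex.normSq w} ∈ 𝓝 w :=
        (isOpen_lt continuous_const Complex.continuous_normSq).mem_nhds h1
      filter_upwards [eventually_mem_nhds_iff.2 hn] with v hv
      rw [dbar_congr (h := fun _ => 0) (by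
        filter_upwards [hv] with u hu using radialCutoff_eq_zero hab (le_of_lt hu)),
        dbar_const, zero_mul]
    exact this.continuousAt
  refine (continuousAt_dbar (contDiff_radialCutoff a b).contDiffAt).mul
    (hc.continuousAt ((Metric.isOpen_ball.sdiff isClosed_singleton).mem_nhds ⟨?_, ?_⟩))
  · rw [mem_ball_zero_iff]
    refine lt_of_pow_lt_pow_left₀ 2 hR.le ?_
    rw [← Complex.normSq_eq_norm_sq]
    linarith
  · rintro rfl
    simp at h0
    linarith

/-- With f(r) the radial profile of the cut-off, the angular integral is -i f'(r) ∮ c dw, and the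
circle integral is the constant C. What remains is ∫₀^∞ f' = -f(0) = -1. -/
theorem integral_dbar_radialCutoff_mul {a b R : ℝ} (ha : 0 < a) (hab : a < b) (hbR : b < R ^ 2)
    (hR : 0 < R) {c : ℂ → ℂ} (hc : ContinuousOn c (Metric.ball 0 R \ {0})) {C : ℂ}
    (hC : ∀ r, 0 < r → r < R → (∮ w in C(0, r), c w) = C) :
    ∫ w, dbar (radialCutoff a b) w * c w = Complex.I * C := by
  set F : ℂ → ℂ := fun w => dbar (radialCutoff a b) w * c w with hF
  have hFc : Continuous F := continuous_radial_integrand ha hab hbR hR hc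
  set κ : ℝ → ℝ := fun t => Real.smoothTransition ((b - t) / (b - a)) with hκ
  have hκ1 : ContDiff ℝ 1 κ :=
    (Real.smoothTransition.contDiff (n := 1)).comp
      ((contDiff_const.sub contDiff_id).div_const _)
  set f : ℝ → ℂ := fun r => (κ (r ^ 2) : ℝ) with hf
  have hf1 : ContDiff ℝ 1 f :=
    Complex.ofRealCLM.contDiff.comp (hκ1.comp (contDiff_id.pow 2))
  have hfd : ∀ r, deriv f r = ((deriv κ (r ^ 2) * (2 * r) : ℝ) : ℂ) := by
    intro r
    have h1 : HasDerivAt (fun r : ℝ => r ^ 2) (2 * r) r := by simpa using hasDerivAt_pow 2 r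
    exact (((hκ1.differentiable (by simp) (r ^ 2)).hasDerivAt.comp r h1).ofReal_comp).deriv
  have hf0 : ∀ r, R ≤ r → f r = 0 := by
    intro r hr
    simp only [hf, hκ]
    rw [Real.smoothTransition.zero_of_nonpos, Complex.ofReal_zero]
    exact div_nonpos_of_nonpos_of_nonneg (by nlinarith) (by linarith)
  have hfs : HasCompactSupport f := by
    refine HasCompactSupport.of_support_subset_isCompact (isCompact_Icc (a := -R) (b := R)) ?_
    intro r hr
    by_contra hcon
    apply hr
    have : f r = f |r| := by simp [hf]
    rw [this]
    apply hf0
    by_contra! hlt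
    exact hcon ⟨(abs_lt.1 hlt).1.le, (abs_lt.1 hlt).2.le⟩
  have hf00 : f 0 = 1 := by
    simp only [hf, hκ]
    rw [Real.smoothTransition.one_of_one_le, Complex.ofReal_one]
    rw [le_div_iff₀ (sub_pos.2 hab)]
    norm_num
    linarith
  have hfd0 : ∀ r, R ≤ r → deriv κ (r ^ 2) = 0 := by
    intro r hr
    have : κ =ᶠ[𝓝 (r ^ 2)] fun _ => 0 := by
      filter_upwards [lt_mem_nhds (show b < r ^ 2 by nlinarith)] with t ht
      exact Real.smoothTransition.zero_of_nonpos
        (div_nonpos_of_nonpos_of_nonneg (by linarith) (by linarith))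
    rw [this.deriv_eq, deriv_const]
  -- The factor `p.1` is the Jacobian of polar coordinates.
  set P : ℝ × ℝ → ℂ := fun p =>
    p.1 • F (p.1 * (Real.cos p.2 + Real.sin p.2 * Complex.I)) with hP
  have hPc : Continuous P := by
    refine continuous_fst.smul (hFc.comp ?_)
    fun_prop
  have hns : ∀ r θ : ℝ, Complex.normSq (r * (Real.cos θ + Real.sin θ * Complex.I)) = r ^ 2 := by
    intro r θ
    rw [Complex.normSq_mul, Complex.normSq_ofReal, Complex.normSq_add_mul_I,
      Real.cos_sq_add_sin_sq, mul_one, sq]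
  have hF' : ∀ r θ : ℝ, F (r * (Real.cos θ + Real.sin θ * Complex.I))
      = 2 * (r * (Real.cos θ + Real.sin θ * Complex.I)) * (deriv κ (r ^ 2) : ℝ)
        * c (r * (Real.cos θ + Real.sin θ * Complex.I)) := by
    intro r θ
    simp only [hF]
    rw [dbar_radialCutoff, hns]
  have hPi : MeasureTheory.IntegrableOn P (Set.Ioi 0 ×ˢ Set.Ioo (-Real.pi) Real.pi) := by
    have h1 : MeasureTheory.IntegrableOn P (Set.Icc 0 R ×ˢ Set.Icc (-Real.pi) Real.pi) :=
      hPc.continuousOn.integrableOn_compact (isCompact_Icc.prod isCompact_Icc)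
    refine h1.of_forall_sdiff_eq_zero (measurableSet_Ioi.prod measurableSet_Ioo) ?_
    rintro ⟨r, θ⟩ ⟨⟨h2, h3⟩, h4⟩
    have hr : R ≤ r := by
      by_contra! hlt
      exact h4 ⟨⟨(Set.mem_Ioi.1 h2).le, hlt.le⟩, Set.Ioo_subset_Icc_self h3⟩
    simp only [hP, hF', hfd0 r hr]
    simp
  calc ∫ w, F w = ∫ p in Set.Ioi (0 : ℝ) ×ˢ Set.Ioo (-Real.pi) Real.pi, P p := by
        rw [← Complex.integral_comp_polarCoord_symm F]
        simp only [Complex.polarCoord_symm_apply, polarCoord_target, hP]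
    _ = ∫ r in Set.Ioi (0 : ℝ), ∫ θ in Set.Ioo (-Real.pi) Real.pi, P (r, θ) :=
        MeasureTheory.setIntegral_prod _ hPi
    _ = ∫ r in Set.Ioi (0 : ℝ), deriv f r * (-Complex.I * C) := by
        refine MeasureTheory.setIntegral_congr_fun measurableSet_Ioi fun r hr => ?_
        have hr : 0 < r := hr
        have key : ∫ θ in Set.Ioo (-Real.pi) Real.pi, P (r, θ)
            = (deriv f r * -Complex.I) * ∮ w in C(0, r), c w := by
          rw [circleIntegral_eq_integral_symm, ← MeasureTheory.integral_const_mul]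
          refine MeasureTheory.setIntegral_congr_fun measurableSet_Ioo fun θ _ => ?_
          simp only [hP, hF', hfd, Complex.real_smul]
          push_cast
          linear_combination (2 * (r : ℂ) ^ 2 * (Complex.cos θ + Complex.sin θ * Complex.I)
            * (deriv κ (r ^ 2) : ℝ) * c (r * (Complex.cos θ + Complex.sin θ * Complex.I)))
              * Complex.I_mul_I
        rw [key]
        -- Beyond radius R nothing is known about the circle integrals, but there f' = 0.
        rcases lt_or_ge r R with h | h
        · rw [hC r hr h]; ring
        · rw [hfd, hfd0 r h]; simp
    _ = Complex.I * C := by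
        rw [MeasureTheory.integral_mul_const, hfs.integral_Ioi_deriv_eq hf1, hf00]
        ring

/-! ### Residues in one variable -/

theorem residueAtZero_eq_of_eventually {F : ℂ → ℂ} {c : ℂ}
    (h : ∀ᶠ r in 𝓝[>] (0 : ℝ), (2 * Real.pi * Complex.I)⁻¹ * (∮ w in C(0, r), F w) = c) :
    residueAtZero F = c :=
  Tendsto.limUnder_eq (tendsto_const_nhds.congr' (h.mono fun _ hr => hr.symm))

theorem eventually_sphere {p : ℂ → Prop} (h : ∀ᶠ w in 𝓝[≠] (0 : ℂ), p w) :
    ∀ᶠ r in 𝓝[>] (0 : ℝ), 0 < r ∧ ∀ w ∈ Metric.sphere (0 : ℂ) r, p w := by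
  obtain ⟨ε, hε, hp⟩ := Metric.eventually_nhds_iff.1 (eventually_nhdsWithin_iff.1 h)
  filter_upwards [Ioo_mem_nhdsGT hε] with r hr
  refine ⟨hr.1, fun w hw => hp ?_ ?_⟩
  · rw [Metric.mem_sphere.1 hw]; exact hr.2
  · rintro rfl
    rw [Metric.mem_sphere, dist_self] at hw
    exact hr.1.ne hw

theorem residueAtZero_congr {F G : ℂ → ℂ} (h : F =ᶠ[𝓝[≠] 0] G) :
    residueAtZero F = residueAtZero G := by
  have : (fun r : ℝ => (2 * Real.pi * Complex.I)⁻¹ * ∮ w in C(0, r), F w)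
      =ᶠ[𝓝[>] 0] fun r : ℝ => (2 * Real.pi * Complex.I)⁻¹ * ∮ w in C(0, r), G w := by
    filter_upwards [eventually_sphere h] with r hr
    rw [circleIntegral.integral_congr hr.1.le hr.2]
  exact congrArg lim (map_congr this)

/-- By Cauchy's theorem on annuli the integral does not depend on the radius, so the limit defining
the residue is already attained at r. -/
theorem circleIntegral_eq_residueAtZero {F : ℂ → ℂ} {R : ℝ}
    (hF : DifferentiableOn ℂ F (Metric.ball 0 R \ {0})) {r : ℝ} (hr : 0 < r) (hrR : r < R) :
    (∮ w in C(0, r), F w) = 2 * Real.pi * Complex.I * residueAtZero F := by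
  have hd : ∀ w ∈ Metric.ball (0 : ℂ) R \ {0}, DifferentiableAt ℂ F w := fun w hw =>
    (hF w hw).differentiableAt ((Metric.isOpen_ball.sdiff isClosed_singleton).mem_nhds hw)
  have : residueAtZero F = (2 * Real.pi * Complex.I)⁻¹ * ∮ w in C(0, r), F w := by
    apply residueAtZero_eq_of_eventually
    filter_upwards [Ioo_mem_nhdsGT hr] with s hs
    have hsub : Metric.closedBall (0 : ℂ) r \ Metric.ball 0 s ⊆ Metric.ball 0 R \ {0} := by
      rintro w ⟨h1, h2⟩
      refine ⟨Metric.closedBall_subset_ball hrR h1, ?_⟩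
      rintro rfl
      exact h2 (Metric.mem_ball_self hs.1)
    rw [Complex.circleIntegral_eq_of_differentiable_on_annulus_off_countable hs.1 hs.2.le
      Set.countable_empty (hF.continuousOn.mono hsub) fun w hw => hd w (hsub
        ⟨Metric.ball_subset_closedBall hw.1.1, fun h => hw.1.2 (Metric.ball_subset_closedBall h)⟩)]
  rw [this, mul_inv_cancel_left₀ Complex.two_pi_I_ne_zero]

theorem MeromorphicAt.exists_differentiableOn {F : ℂ → ℂ} (hF : MeromorphicAt F 0) :
    ∃ R > 0, DifferentiableOn ℂ F (Metric.ball 0 R \ {0}) := by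
  obtain ⟨ε, hε, hp⟩ := Metric.eventually_nhds_iff.1
    (eventually_nhdsWithin_iff.1 hF.eventually_analyticAt)
  exact ⟨ε, hε, fun w hw => (hp hw.1 hw.2).differentiableAt.differentiableWithinAt⟩

theorem eventually_circleIntegral_eq {F : ℂ → ℂ} (hF : MeromorphicAt F 0) :
    ∀ᶠ r in 𝓝[>] (0 : ℝ), CircleIntegrable F 0 r ∧
      (∮ w in C(0, r), F w) = 2 * Real.pi * Complex.I * residueAtZero F := by
  obtain ⟨R, hR, h⟩ := MeromorphicAt.exists_differentiableOn hF
  filter_upwards [Ioo_mem_nhdsGT hR] with r hr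
  refine ⟨(h.continuousOn.mono ?_).circleIntegrable hr.1.le,
    circleIntegral_eq_residueAtZero h hr.1 hr.2⟩
  intro w hw
  rw [mem_sphere_zero_iff_norm] at hw
  refine ⟨by simpa [hw] using hr.2, ?_⟩
  rintro rfl
  simp at hw
  exact hr.1.ne hw

theorem residueAtZero_add {F G : ℂ → ℂ} (hF : MeromorphicAt F 0) (hG : MeromorphicAt G 0) :
    residueAtZero (fun w => F w + G w) = residueAtZero F + residueAtZero G := by
  apply residueAtZero_eq_of_eventually
  filter_upwards [eventually_circleIntegral_eq hF, eventually_circleIntegral_eq hG] with r h1 h2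
  rw [circleIntegral.integral_add h1.1 h2.1, h1.2, h2.2, ← mul_add,
    inv_mul_cancel_left₀ Complex.two_pi_I_ne_zero]

theorem residueAtZero_const_mul {F : ℂ → ℂ} (hF : MeromorphicAt F 0) (c : ℂ) :
    residueAtZero (fun w => c * F w) = c * residueAtZero F := by
  apply residueAtZero_eq_of_eventually
  filter_upwards [eventually_circleIntegral_eq hF] with r h1
  rw [circleIntegral.integral_const_mul, h1.2, mul_left_comm c,
    inv_mul_cancel_left₀ Complex.two_pi_I_ne_zero]

theorem residueAtZero_zero : residueAtZero (fun _ => 0) = 0 := by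
  apply residueAtZero_eq_of_eventually
  simp [circleIntegral]

/-- F itself is a single-valued primitive along every small circle. -/
theorem residueAtZero_deriv {F : ℂ → ℂ} (hF : MeromorphicAt F 0) :
    residueAtZero (deriv F) = 0 := by
  apply residueAtZero_eq_of_eventually
  filter_upwards [eventually_sphere hF.eventually_analyticAt] with r hr
  rw [circleIntegral.integral_eq_zero_of_hasDerivWithinAt hr.1.le fun w hw =>
    (hr.2 w hw).differentiableAt.hasDerivAt.hasDerivWithinAt, mul_zero]

theorem exists_analyticAt_eventuallyEq {F : ℂ → ℂ} {p : ℂ} (hF : MeromorphicAt F p)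
    (h0 : 0 ≤ meromorphicOrderAt F p) : ∃ G, AnalyticAt ℂ G p ∧ F =ᶠ[𝓝[≠] p] G :=
  (hF.meromorphicOrderAt_nonneg_iff).1 h0

theorem residueAtZero_eq_zero_of_order_nonneg {F : ℂ → ℂ} (hF : MeromorphicAt F 0)
    (h0 : 0 ≤ meromorphicOrderAt F 0) : residueAtZero F = 0 := by
  obtain ⟨G, hG, hFG⟩ := exists_analyticAt_eventuallyEq hF h0
  rw [residueAtZero_congr hFG]
  apply residueAtZero_eq_of_eventually
  obtain ⟨ε, hε, hp⟩ := Metric.eventually_nhds_iff.1 hG.eventually_analyticAt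
  filter_upwards [Ioo_mem_nhdsGT hε] with r hr
  have hd : ∀ w ∈ Metric.closedBall (0 : ℂ) r, DifferentiableAt ℂ G w := fun w hw =>
    (hp (lt_of_le_of_lt hw hr.2)).differentiableAt
  rw [Complex.circleIntegral_eq_zero_of_differentiable_on_off_countable hr.1.le
    Set.countable_empty (fun w hw => (hd w hw).continuousAt.continuousWithinAt)
    fun w hw => hd w (Metric.ball_subset_closedBall hw.1), mul_zero]

/-- The function w⁻ᵏF is bounded near 0, so its order is not negative: at a pole it would tend to
infinity. Orders of products add. -/
theorem IsOPow.le_order {F : ℂ → ℂ} {k : ℤ} (hF : MeromorphicAt F 0) (h : IsOPow F k) :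
    (k : WithTop ℤ) ≤ meromorphicOrderAt F 0 := by
  have hz : MeromorphicAt (fun w : ℂ => w ^ (-k)) 0 := (MeromorphicAt.id 0).zpow (-k)
  have ho : meromorphicOrderAt (fun w : ℂ => w ^ (-k)) 0 = ((-k : ℤ) : WithTop ℤ) := by
    have h1 := meromorphicOrderAt_zpow_id_sub_const (𝕜 := ℂ) (x := 0) (n := -k)
    rw [← h1]
    congr 1
    funext w
    simp
  have hb : (fun w : ℂ => w ^ (-k) * F w) =O[𝓝[≠] 0] fun _ => (1 : ℂ) := by
    refine ((Asymptotics.isBigO_refl (fun w : ℂ => w ^ (-k)) _).mul h).congr' .rfl ?_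
    filter_upwards [self_mem_nhdsWithin] with w hw
    rw [← zpow_add₀ hw, neg_add_cancel, zpow_zero]
  have h0 : 0 ≤ meromorphicOrderAt (fun w : ℂ => w ^ (-k) * F w) 0 := by
    by_contra! hneg
    exact not_isBoundedUnder_of_tendsto_atTop
      (tendsto_norm_cobounded_atTop.comp (tendsto_cobounded_of_meromorphicOrderAt_neg hneg))
      ((Asymptotics.isBigO_one_iff ℂ).1 hb)
  have he : meromorphicOrderAt (fun w : ℂ => w ^ (-k) * F w) 0 = _ :=
    meromorphicOrderAt_mul hz hF
  rw [he, ho] at h0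
  cases hF' : meromorphicOrderAt F 0 with
  | top => exact le_top
  | coe n =>
    rw [hF'] at h0
    norm_cast at h0 ⊢
    omega

theorem sub_one_le_order_deriv {F : ℂ → ℂ} {k : ℤ} (hF : MeromorphicAt F 0)
    (h : (k : WithTop ℤ) ≤ meromorphicOrderAt F 0) :
    ((k - 1 : ℤ) : WithTop ℤ) ≤ meromorphicOrderAt (deriv F) 0 := by
  cases hF' : meromorphicOrderAt F 0 with
  | top =>
    rw [meromorphicOrderAt_eq_top_iff] at hF'
    have : meromorphicOrderAt (deriv F) 0 = ⊤ := by
      rw [meromorphicOrderAt_eq_top_iff]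
      have h2 : F =ᶠ[𝓝[≠] 0] fun _ => 0 := hF'
      filter_upwards [h2.nhdsNE_deriv] with w hw
      simpa using hw
    rw [this]
    exact le_top
  | coe n =>
    rw [hF'] at h
    have h : k ≤ n := by exact_mod_cast h
    -- Differentiation lowers a nonzero finite order by exactly one. At order zero the order of the
    -- derivative is only known to be nonnegative, which an analytic representative provides.
    by_cases hn : n = 0
    · subst hn
      obtain ⟨G, hG, hFG⟩ := exists_analyticAt_eventuallyEq hF (by rw [hF']; rfl)
      rw [meromorphicOrderAt_congr hFG.nhdsNE_deriv]
      refine le_trans ?_ hG.deriv.meromorphicOrderAt_nonneg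
      norm_cast
      omega
    · rw [meromorphicOrderAt_deriv_eq_sub_one (by exact_mod_cast hn) hF']
      norm_cast
      omega

/-- The residue of `f dh` vanishes when the orders of `f` and `h` add up to at least one. -/
theorem residueAtZero_mul_deriv_eq_zero {F H : ℂ → ℂ} {k m : ℤ} (hF : MeromorphicAt F 0)
    (hH : MeromorphicAt H 0) (hk : IsOPow F k) (hm : IsOPow H m) (hkm : 1 ≤ k + m) :
    residueAtZero (fun w => F w * deriv H w) = 0 := by
  refine residueAtZero_eq_zero_of_order_nonneg (hF.mul hH.deriv) ?_
  have he : meromorphicOrderAt (fun w => F w * deriv H w) 0 = _ :=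
    meromorphicOrderAt_mul hF hH.deriv
  rw [he]
  refine le_trans ?_ (add_le_add (hk.le_order hF) (sub_one_le_order_deriv hH (hm.le_order hH)))
  norm_cast
  omega

/-! ### Supports and transitions between coordinates. -/

section ResidueTheorem

variable {X : Type*} [TopologicalSpace X]

theorem eventually_symm_of_eventually {z : OpenPartialHomeomorph X ℂ} {w : ℂ} (hw : w ∈ z.target)
    {p : X → Prop} (h : ∀ᶠ x in 𝓝 (z.symm w), p x) : ∀ᶠ v in 𝓝 w, p (z.symm v) :=
  (z.continuousAt_symm hw).eventually h

theorem isOpen_transition (z z' : OpenPartialHomeomorph X ℂ) :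
    IsOpen (z.target ∩ z.symm ⁻¹' z'.source) :=
  z.symm.isOpen_inter_preimage z'.open_source

theorem integrableOn_target_of_eq_zero {z : OpenPartialHomeomorph X ℂ} {F : ℂ → ℂ}
    (hF : ContinuousOn F z.target) {K : Set X} (hK : IsCompact K) (hKz : K ⊆ z.source)
    (h0 : ∀ w ∈ z.target, z.symm w ∉ K → F w = 0) :
    MeasureTheory.IntegrableOn F z.target := by
  have hc : IsCompact (z '' K) := hK.image_of_continuousOn (z.continuousOn.mono hKz)
  have hsub : z '' K ⊆ z.target := by
    rintro _ ⟨x, hx, rfl⟩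
    exact z.map_source (hKz hx)
  refine ((hF.mono hsub).integrableOn_compact hc).of_forall_sdiff_eq_zero
    z.open_target.measurableSet fun w hw => h0 w hw.1 fun h => hw.2 ⟨_, h, z.right_inv hw.1⟩

theorem dbar_comp_symm_eq_zero {z : OpenPartialHomeomorph X ℂ} {φ : X → ℂ} {w : ℂ}
    (hw : w ∈ z.target) {c : ℂ} (h : ∀ᶠ x in 𝓝 (z.symm w), φ x = c) :
    dbar (φ ∘ z.symm) w = 0 := by
  have e : φ ∘ z.symm =ᶠ[𝓝 w] fun _ => c := eventually_symm_of_eventually hw h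
  rw [dbar_congr e, dbar_const]

theorem dbar_comp_symm_eq_zero_of_notMem {z : OpenPartialHomeomorph X ℂ} {φ : X → ℂ} {w : ℂ}
    (hw : w ∈ z.target) {K : Set X} (hK : IsClosed K) (h0 : ∀ x ∉ K, φ x = 0)
    (hwK : z.symm w ∉ K) : dbar (φ ∘ z.symm) w = 0 :=
  dbar_comp_symm_eq_zero hw (mem_of_superset (hK.isOpen_compl.mem_nhds hwK) h0)

variable [ChartedSpace ℂ X]

theorem mdifferentiable_of_mem_maximalAtlas {z : OpenPartialHomeomorph X ℂ}
    (hz : z ∈ IsManifold.maximalAtlas 𝓘(ℂ) ω X) : z.MDifferentiable 𝓘(ℂ) 𝓘(ℂ) :=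
  ⟨(contMDiffOn_of_mem_maximalAtlas hz).mdifferentiableOn (by simp),
    (contMDiffOn_symm_of_mem_maximalAtlas hz).mdifferentiableOn (by simp)⟩

/-! ### Functions in local coordinates -/

/-- The function `F` with `f dh = F dz` in the coordinate `z`. -/
noncomputable def diffCoeff (z : OpenPartialHomeomorph X ℂ) (f h : X → ℂ) (w : ℂ) : ℂ :=
  f (z.symm w) * deriv (h ∘ z.symm) w

/-- A function on the surface which is continuously differentiable over the reals. -/
def IsC1 (φ : X → ℂ) : Prop :=
  ∀ z ∈ IsManifold.maximalAtlas 𝓘(ℂ) ω X, ∀ w ∈ z.target, ContDiffAt ℝ 1 (φ ∘ z.symm) w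

theorem IsC1.mul {φ χ : X → ℂ} (h : IsC1 φ) (h' : IsC1 χ) : IsC1 fun x => φ x * χ x :=
  fun z hz w hw => (h z hz w hw).mul (h' z hz w hw)

theorem IsC1.div {φ χ : X → ℂ} (h : IsC1 φ) (h' : IsC1 χ) (h0 : ∀ x, χ x ≠ 0) :
    IsC1 fun x => φ x / χ x := by
  intro z hz w hw
  simp only [div_eq_mul_inv]
  exact (h z hz w hw).mul ((h' z hz w hw).inv (h0 _))

theorem IsC1.const_sub {φ : X → ℂ} (h : IsC1 φ) (c : ℂ) : IsC1 fun x => c - φ x :=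
  fun z hz w hw => contDiffAt_const.sub (h z hz w hw)

theorem IsC1.sum {ι : Type*} {s : Finset ι} {φ : ι → X → ℂ} (h : ∀ i ∈ s, IsC1 (φ i)) :
    IsC1 fun x => ∑ i ∈ s, φ i x := fun z hz w hw =>
  ContDiffAt.sum (f := fun i w => φ i (z.symm w)) fun i hi => h i hi z hz w hw

theorem differentiableAt_comp_symm {z : OpenPartialHomeomorph X ℂ}
    (hz : z ∈ IsManifold.maximalAtlas 𝓘(ℂ) ω X) {f : X → ℂ} {w : ℂ} (hw : w ∈ z.target)
    (hf : MDifferentiableAt 𝓘(ℂ) 𝓘(ℂ) f (z.symm w)) : DifferentiableAt ℂ (f ∘ z.symm) w :=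
  (hf.comp w ((mdifferentiable_of_mem_maximalAtlas hz).mdifferentiableAt_symm
    hw)).differentiableAt

theorem mdifferentiableAt_of_comp_symm {z : OpenPartialHomeomorph X ℂ}
    (hz : z ∈ IsManifold.maximalAtlas 𝓘(ℂ) ω X) {f : X → ℂ} {x : X} (hx : x ∈ z.source)
    (hf : DifferentiableAt ℂ (f ∘ z.symm) (z x)) : MDifferentiableAt 𝓘(ℂ) 𝓘(ℂ) f x := by
  have h : MDifferentiableAt 𝓘(ℂ) 𝓘(ℂ) ((f ∘ z.symm) ∘ z) x :=
    hf.mdifferentiableAt.comp x ((mdifferentiable_of_mem_maximalAtlas hz).mdifferentiableAt hx)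
  refine h.congr_of_eventuallyEq ?_
  filter_upwards [z.open_source.mem_nhds hx] with y hy
  simp [z.left_inv hy]

theorem differentiableAt_transition {z z' : OpenPartialHomeomorph X ℂ}
    (hz : z ∈ IsManifold.maximalAtlas 𝓘(ℂ) ω X) (hz' : z' ∈ IsManifold.maximalAtlas 𝓘(ℂ) ω X)
    {w : ℂ} (hw : w ∈ z.target) (hw' : z.symm w ∈ z'.source) :
    DifferentiableAt ℂ (z' ∘ z.symm) w :=
  differentiableAt_comp_symm hz hw
    ((mdifferentiable_of_mem_maximalAtlas hz').mdifferentiableAt hw')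

theorem analyticAt_transition {z z' : OpenPartialHomeomorph X ℂ}
    (hz : z ∈ IsManifold.maximalAtlas 𝓘(ℂ) ω X) (hz' : z' ∈ IsManifold.maximalAtlas 𝓘(ℂ) ω X)
    {w : ℂ} (hw : w ∈ z.target) (hw' : z.symm w ∈ z'.source) :
    AnalyticAt ℂ (z' ∘ z.symm) w :=
  DifferentiableOn.analyticAt (s := z.target ∩ z.symm ⁻¹' z'.source)
    (fun _ hv => (differentiableAt_transition hz hz' hv.1 hv.2).differentiableWithinAt)
    ((isOpen_transition z z').mem_nhds ⟨hw, hw'⟩)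

theorem diffCoeff_transition {z z' : OpenPartialHomeomorph X ℂ}
    (hz : z ∈ IsManifold.maximalAtlas 𝓘(ℂ) ω X) (hz' : z' ∈ IsManifold.maximalAtlas 𝓘(ℂ) ω X)
    (f : X → ℂ) {h : X → ℂ} {w : ℂ} (hw : w ∈ z.target) (hw' : z.symm w ∈ z'.source)
    (hh : MDifferentiableAt 𝓘(ℂ) 𝓘(ℂ) h (z.symm w)) :
    diffCoeff z f h w = diffCoeff z' f h ((z' ∘ z.symm) w) * deriv (z' ∘ z.symm) w := by
  have e : h ∘ z.symm =ᶠ[𝓝 w] (h ∘ z'.symm) ∘ (z' ∘ z.symm) := by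
    filter_upwards [(isOpen_transition z z').mem_nhds ⟨hw, hw'⟩] with v hv
    simp [z'.left_inv hv.2]
  have hd : DifferentiableAt ℂ (h ∘ z'.symm) ((z' ∘ z.symm) w) := by
    refine differentiableAt_comp_symm hz' (z'.map_source hw') ?_
    simpa [z'.left_inv hw'] using hh
  rw [diffCoeff, e.deriv_eq, deriv_comp w hd (differentiableAt_transition hz hz' hw hw'),
    diffCoeff, Function.comp_apply, z'.left_inv hw', mul_assoc]

theorem dbar_transition {z z' : OpenPartialHomeomorph X ℂ}
    (hz : z ∈ IsManifold.maximalAtlas 𝓘(ℂ) ω X) (hz' : z' ∈ IsManifold.maximalAtlas 𝓘(ℂ) ω X)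
    {φ : X → ℂ} (hφ : IsC1 φ) {w : ℂ} (hw : w ∈ z.target) (hw' : z.symm w ∈ z'.source) :
    dbar (φ ∘ z.symm) w
      = dbar (φ ∘ z'.symm) ((z' ∘ z.symm) w) * starRingEnd ℂ (deriv (z' ∘ z.symm) w) := by
  have e : φ ∘ z.symm =ᶠ[𝓝 w] (φ ∘ z'.symm) ∘ (z' ∘ z.symm) := by
    filter_upwards [(isOpen_transition z z').mem_nhds ⟨hw, hw'⟩] with v hv
    simp [z'.left_inv hv.2]
  rw [dbar_congr e, dbar_comp ((hφ z' hz' _ (z'.map_source hw')).differentiableAt (by simp))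
    (differentiableAt_transition hz hz' hw hw')]

theorem analyticAt_comp_symm {z : OpenPartialHomeomorph X ℂ}
    (hz : z ∈ IsManifold.maximalAtlas 𝓘(ℂ) ω X) {f : X → ℂ} {w : ℂ} (hw : w ∈ z.target)
    (hf : ∀ᶠ x in 𝓝 (z.symm w), MDifferentiableAt 𝓘(ℂ) 𝓘(ℂ) f x) :
    AnalyticAt ℂ (f ∘ z.symm) w := by
  rw [Complex.analyticAt_iff_eventually_differentiableAt]
  filter_upwards [eventually_symm_of_eventually hw hf, z.open_target.mem_nhds hw] with v hv hv'
  exact differentiableAt_comp_symm hz hv' hv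

theorem analyticAt_diffCoeff {z : OpenPartialHomeomorph X ℂ}
    (hz : z ∈ IsManifold.maximalAtlas 𝓘(ℂ) ω X) {f h : X → ℂ} {w : ℂ} (hw : w ∈ z.target)
    (hf : ∀ᶠ x in 𝓝 (z.symm w), MDifferentiableAt 𝓘(ℂ) 𝓘(ℂ) f x)
    (hh : ∀ᶠ x in 𝓝 (z.symm w), MDifferentiableAt 𝓘(ℂ) 𝓘(ℂ) h x) :
    AnalyticAt ℂ (diffCoeff z f h) w :=
  (analyticAt_comp_symm hz hw hf).mul (analyticAt_comp_symm hz hw hh).deriv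

/-! ### The `(1,1)`-form `∂̄φ ∧ f dh` -/

/-- The coefficient of `2 ∂̄φ ∧ f dh` in the coordinate `z`. -/
noncomputable def dbarCoeff (z : OpenPartialHomeomorph X ℂ) (φ f h : X → ℂ) (w : ℂ) : ℂ :=
  dbar (φ ∘ z.symm) w * diffCoeff z f h w

/-- On S the form f dh may be singular, but φ is locally constant there, so the product is zero in a
neighbourhood. -/
theorem continuousOn_dbarCoeff {z : OpenPartialHomeomorph X ℂ}
    (hz : z ∈ IsManifold.maximalAtlas 𝓘(ℂ) ω X) {φ f h : X → ℂ} (hφ : IsC1 φ) {S : Set X}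
    (hS : IsClosed S) (hf : ∀ x ∉ S, MDifferentiableAt 𝓘(ℂ) 𝓘(ℂ) f x)
    (hh : ∀ x ∉ S, MDifferentiableAt 𝓘(ℂ) 𝓘(ℂ) h x)
    (hloc : ∀ x ∈ S, ∃ c, ∀ᶠ y in 𝓝 x, φ y = c) :
    ContinuousOn (dbarCoeff z φ f h) z.target := by
  intro w hw
  apply ContinuousAt.continuousWithinAt
  by_cases hx : z.symm w ∈ S
  · obtain ⟨c, hc⟩ := hloc _ hx
    have : dbarCoeff z φ f h =ᶠ[𝓝 w] fun _ => 0 := by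
      filter_upwards [eventually_symm_of_eventually hw hc.eventually_nhds,
        z.open_target.mem_nhds hw] with v hv hv'
      rw [dbarCoeff, dbar_comp_symm_eq_zero hv' hv, zero_mul]
    exact this.continuousAt
  · have hn : Sᶜ ∈ 𝓝 (z.symm w) := hS.isOpen_compl.mem_nhds hx
    exact (continuousAt_dbar (hφ z hz w hw)).mul
      (analyticAt_diffCoeff hz hw (mem_of_superset hn hf) (mem_of_superset hn hh)).continuousAt

/-- For the transition map ψ, f dh contributes ψ' and ∂̄φ contributes its conjugate. On S both sides
vanish. -/
theorem dbarCoeff_transition {z z' : OpenPartialHomeomorph X ℂ}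
    (hz : z ∈ IsManifold.maximalAtlas 𝓘(ℂ) ω X) (hz' : z' ∈ IsManifold.maximalAtlas 𝓘(ℂ) ω X)
    {φ f h : X → ℂ} (hφ : IsC1 φ) {S : Set X}
    (hh : ∀ x ∉ S, MDifferentiableAt 𝓘(ℂ) 𝓘(ℂ) h x)
    (hloc : ∀ x ∈ S, ∃ c, ∀ᶠ y in 𝓝 x, φ y = c)
    {w : ℂ} (hw : w ∈ z.target) (hw' : z.symm w ∈ z'.source) :
    dbarCoeff z φ f h w
      = (deriv (z' ∘ z.symm) w * starRingEnd ℂ (deriv (z' ∘ z.symm) w))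
        * dbarCoeff z' φ f h ((z' ∘ z.symm) w) := by
  by_cases hx : z.symm w ∈ S
  · obtain ⟨c, hc⟩ := hloc _ hx
    have h' : dbar (φ ∘ z'.symm) ((z' ∘ z.symm) w) = 0 :=
      dbar_comp_symm_eq_zero (z'.map_source hw') (c := c) (by
        rwa [Function.comp_apply, z'.left_inv hw'])
    rw [dbarCoeff, dbarCoeff, dbar_comp_symm_eq_zero hw hc, h']
    ring
  · rw [dbarCoeff, dbarCoeff, dbar_transition hz hz' hφ hw hw',
      diffCoeff_transition hz hz' f hw hw' (hh _ hx)]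
    ring

/-- The integral of `χ ∂̄φ ∧ f dh` may be computed in a coordinate around the support of `φ` as
well as in a coordinate around the support of `χ`. -/
theorem integral_mul_dbarCoeff_transition [T2Space X] {z z' : OpenPartialHomeomorph X ℂ}
    (hz : z ∈ IsManifold.maximalAtlas 𝓘(ℂ) ω X) (hz' : z' ∈ IsManifold.maximalAtlas 𝓘(ℂ) ω X)
    {φ χ f h : X → ℂ} (hφ : IsC1 φ) {S : Set X}
    (hh : ∀ x ∉ S, MDifferentiableAt 𝓘(ℂ) 𝓘(ℂ) h x)
    (hloc : ∀ x ∈ S, ∃ c, ∀ᶠ y in 𝓝 x, φ y = c)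
    {K K' : Set X} (hK : IsCompact K) (hKz : K ⊆ z.source) (h0 : ∀ x ∉ K, φ x = 0)
    (hKz' : K' ⊆ z'.source) (h0' : ∀ x ∉ K', χ x = 0) :
    ∫ w in z.target, χ (z.symm w) * dbarCoeff z φ f h w
      = ∫ w in z'.target, χ (z'.symm w) * dbarCoeff z' φ f h w := by
  -- Outside the overlap of the two domains χ vanishes.
  have e1 : ∫ w in z.target, χ (z.symm w) * dbarCoeff z φ f h w
      = ∫ w in z.target ∩ z.symm ⁻¹' z'.source, χ (z.symm w) * dbarCoeff z φ f h w := by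
    refine (MeasureTheory.setIntegral_eq_of_subset_of_forall_sdiff_eq_zero
      z.open_target.measurableSet Set.inter_subset_left fun w hw => ?_)
    rw [h0' _ fun h => hw.2 ⟨hw.1, hKz' h⟩, zero_mul]
  -- Here it is ∂̄φ that vanishes outside the overlap, since φ is zero on the open complement of K.
  have e2 : ∫ w in z'.target, χ (z'.symm w) * dbarCoeff z' φ f h w
      = ∫ w in z'.target ∩ z'.symm ⁻¹' z.source, χ (z'.symm w) * dbarCoeff z' φ f h w := by
    refine (MeasureTheory.setIntegral_eq_of_subset_of_forall_sdiff_eq_zero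
      z'.open_target.measurableSet Set.inter_subset_left fun w hw => ?_)
    rw [dbarCoeff, dbar_comp_symm_eq_zero_of_notMem hw.1 hK.isClosed h0
      fun h => hw.2 ⟨hw.1, hKz h⟩, zero_mul, mul_zero]
  have himg : z'.target ∩ z'.symm ⁻¹' z.source
      = (z' ∘ z.symm) '' (z.target ∩ z.symm ⁻¹' z'.source) := by
    ext v
    constructor
    · rintro ⟨h1, h2⟩
      refine ⟨z (z'.symm v), ⟨z.map_source h2, ?_⟩, ?_⟩
      · simpa [z.left_inv h2] using z'.map_target h1
      · simp [z.left_inv h2, z'.right_inv h1]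
    · rintro ⟨w, ⟨h1, h2⟩, rfl⟩
      refine ⟨z'.map_source h2, ?_⟩
      simpa [z'.left_inv h2] using z.map_target h1
  have hinj : Set.InjOn (z' ∘ z.symm) (z.target ∩ z.symm ⁻¹' z'.source) := by
    intro v hv w hw hvw
    exact z.symm.injOn hv.1 hw.1 (z'.injOn hv.2 hw.2 hvw)
  rw [e1, e2, himg, integral_image_holomorphic (isOpen_transition z z')
    (fun w hw => (differentiableAt_transition hz hz' hw.1 hw.2).differentiableWithinAt) hinj]
  refine MeasureTheory.setIntegral_congr_fun (isOpen_transition z z').measurableSet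
    fun w hw => ?_
  rw [dbarCoeff_transition hz hz' hφ hh hloc hw.1 hw.2, Function.comp_apply, z'.left_inv hw.2]
  ring

/-- The integral of `∂̄(∑ φ_i) ∧ f dh` over the surface, for a partition of unity `φ_i`. -/
theorem sum_integral_dbarCoeff_eq_zero [T2Space X] {ι : Type*} [Fintype ι]
    {z : ι → OpenPartialHomeomorph X ℂ} (hz : ∀ i, z i ∈ IsManifold.maximalAtlas 𝓘(ℂ) ω X)
    {φ : ι → X → ℂ} (hφ : ∀ i, IsC1 (φ i)) {K : ι → Set X} (hK : ∀ i, IsCompact (K i))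
    (hKz : ∀ i, K i ⊆ (z i).source) (h0 : ∀ i, ∀ x ∉ K i, φ i x = 0)
    (hsum : ∀ x, ∑ i, φ i x = 1) {f h : X → ℂ} {S : Set X} (hS : IsClosed S)
    (hf : ∀ x ∉ S, MDifferentiableAt 𝓘(ℂ) 𝓘(ℂ) f x)
    (hh : ∀ x ∉ S, MDifferentiableAt 𝓘(ℂ) 𝓘(ℂ) h x)
    (hloc : ∀ i, ∀ x ∈ S, ∃ c, ∀ᶠ y in 𝓝 x, φ i y = c) :
    ∑ i, ∫ w in (z i).target, dbarCoeff (z i) (φ i) f h w = 0 := by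
  have hφc : ∀ i j, ContinuousOn (fun w => φ j ((z i).symm w)) (z i).target := fun i j w hw =>
    (hφ j _ (hz i) w hw).continuousAt.continuousWithinAt
  have hωc : ∀ i j, ContinuousOn (dbarCoeff (z i) (φ j) f h) (z i).target := fun i j =>
    continuousOn_dbarCoeff (hz i) (hφ j) hS hf hh (hloc j)
  -- Integrability has two sources: in the coordinate i the integrand is confined by ∂̄φ_i, in the
  -- coordinate j by φ_j.
  have h1 : ∀ i j, MeasureTheory.IntegrableOn
      (fun w => φ j ((z i).symm w) * dbarCoeff (z i) (φ i) f h w) (z i).target := fun i j =>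
    integrableOn_target_of_eq_zero ((hφc i j).mul (hωc i i)) (hK i) (hKz i) fun w hw hwK => by
      rw [dbarCoeff, dbar_comp_symm_eq_zero_of_notMem hw (hK i).isClosed (h0 i) hwK]
      ring
  have h2 : ∀ i j, MeasureTheory.IntegrableOn
      (fun w => φ j ((z j).symm w) * dbarCoeff (z j) (φ i) f h w) (z j).target := fun i j =>
    integrableOn_target_of_eq_zero ((hφc j j).mul (hωc j i)) (hK j) (hKz j) fun w hw hwK => by
      rw [h0 j _ hwK, zero_mul]
  -- Insert 1 = ∑ φ_j, move the (i, j) term to the coordinate j, and sum over i first, which leaves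
  -- ∂̄(∑ φ_i) = ∂̄1 = 0.
  calc ∑ i, ∫ w in (z i).target, dbarCoeff (z i) (φ i) f h w
      = ∑ i, ∑ j, ∫ w in (z i).target, φ j ((z i).symm w) * dbarCoeff (z i) (φ i) f h w := by
        refine Finset.sum_congr rfl fun i _ => ?_
        rw [← MeasureTheory.integral_finsetSum _ fun j _ => h1 i j]
        simp only [← Finset.sum_mul, hsum, one_mul]
    _ = ∑ i, ∑ j, ∫ w in (z j).target, φ j ((z j).symm w) * dbarCoeff (z j) (φ i) f h w :=
        Finset.sum_congr rfl fun i _ => Finset.sum_congr rfl fun j _ =>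
          integral_mul_dbarCoeff_transition (hz i) (hz j) (hφ i) hh (hloc i) (hK i) (hKz i)
            (h0 i) (hKz j) (h0 j)
    _ = ∑ j, ∑ i, ∫ w in (z j).target, φ j ((z j).symm w) * dbarCoeff (z j) (φ i) f h w :=
        Finset.sum_comm
    _ = 0 := by
        refine Finset.sum_eq_zero fun j _ => ?_
        rw [← MeasureTheory.integral_finsetSum _ fun i _ => h2 i j]
        refine MeasureTheory.setIntegral_eq_zero_of_forall_eq_zero fun w hw => ?_
        rw [← Finset.mul_sum]
        simp only [dbarCoeff]
        rw [← Finset.sum_mul, ← dbar_sum Finset.univ fun i _ =>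
          (hφ i _ (hz j) w hw).differentiableAt (by simp)]
        simp only [Function.comp_apply, hsum, dbar_const]
        ring

/-- **Stokes' theorem** for a form `φ f dh` with compact support in a coordinate domain. -/
theorem integral_dbarCoeff_eq_zero [T2Space X] {z : OpenPartialHomeomorph X ℂ}
    (hz : z ∈ IsManifold.maximalAtlas 𝓘(ℂ) ω X) {φ f h : X → ℂ} (hφ : IsC1 φ) {S : Set X}
    (hS : IsClosed S) (hf : ∀ x ∉ S, MDifferentiableAt 𝓘(ℂ) 𝓘(ℂ) f x)
    (hh : ∀ x ∉ S, MDifferentiableAt 𝓘(ℂ) 𝓘(ℂ) h x)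
    (hloc : ∀ x ∈ S, ∀ᶠ y in 𝓝 x, φ y = 0)
    {K : Set X} (hK : IsCompact K) (hKz : K ⊆ z.source) (h0 : ∀ x ∉ K, φ x = 0) :
    ∫ w in z.target, dbarCoeff z φ f h w = 0 := by
  classical
  have hcK : IsCompact (z '' K) := hK.image_of_continuousOn (z.continuousOn.mono hKz)
  have hsub : z '' K ⊆ z.target := by
    rintro _ ⟨x, hx, rfl⟩
    exact z.map_source (hKz hx)
  -- G is the coefficient of φ f dh, extended by zero. It is C¹ because K is compact in the
  -- coordinate domain and φ vanishes near S. Off S the form f dh is holomorphic, so ∂̄ falls on φ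
  -- alone.
  set G : ℂ → ℂ := z.target.indicator fun w => φ (z.symm w) * diffCoeff z f h w with hG
  have hGt : ∀ w ∈ z.target, G =ᶠ[𝓝 w] fun w => φ (z.symm w) * diffCoeff z f h w := fun w hw => by
    filter_upwards [z.open_target.mem_nhds hw] with v hv
    exact Set.indicator_of_mem hv _
  have hG0 : ∀ w ∉ z '' K, G w = 0 := by
    intro w hw
    by_cases hwt : w ∈ z.target
    · rw [hG, Set.indicator_of_mem hwt, h0 _ fun h => hw ⟨_, h, z.right_inv hwt⟩, zero_mul]
    · exact Set.indicator_of_notMem hwt _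
  have hG0' : ∀ w ∉ z '' K, G =ᶠ[𝓝 w] fun _ => 0 := fun w hw =>
    mem_of_superset (hcK.isClosed.isOpen_compl.mem_nhds hw) hG0
  have hS0 : ∀ w ∈ z.target, z.symm w ∈ S → ∀ᶠ v in 𝓝 w, φ (z.symm v) = 0 := fun w hw hx =>
    eventually_symm_of_eventually hw (hloc _ hx)
  have han : ∀ w ∈ z.target, z.symm w ∉ S → AnalyticAt ℂ (diffCoeff z f h) w := by
    intro w hw hx
    have hn : Sᶜ ∈ 𝓝 (z.symm w) := hS.isOpen_compl.mem_nhds hx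
    exact analyticAt_diffCoeff hz hw (mem_of_superset hn hf) (mem_of_superset hn hh)
  have hG1 : ContDiff ℝ 1 G := by
    rw [contDiff_iff_contDiffAt]
    intro w
    by_cases hw : w ∈ z.target
    · refine ContDiffAt.congr_of_eventuallyEq ?_ (hGt w hw)
      by_cases hx : z.symm w ∈ S
      · refine (contDiffAt_const (c := (0 : ℂ))).congr_of_eventuallyEq ?_
        filter_upwards [hS0 w hw hx] with v hv
        rw [hv, zero_mul]
      · exact (hφ z hz w hw).mul ((han w hw hx).contDiffAt.restrict_scalars ℝ)
    · exact (contDiffAt_const (c := (0 : ℂ))).congr_of_eventuallyEq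
        (hG0' w fun h => hw (hsub h))
  have hGs : HasCompactSupport G :=
    HasCompactSupport.of_support_subset_isCompact hcK fun w hw => by
      by_contra h
      exact hw (hG0 w h)
  have hd : ∀ w ∈ z.target, dbarCoeff z φ f h w = dbar G w := by
    intro w hw
    rw [dbar_congr (hGt w hw), dbarCoeff]
    by_cases hx : z.symm w ∈ S
    · have e1 : (fun w => φ (z.symm w) * diffCoeff z f h w) =ᶠ[𝓝 w] fun _ => 0 := by
        filter_upwards [hS0 w hw hx] with v hv
        rw [hv, zero_mul]
      rw [dbar_congr e1, dbar_const, dbar_comp_symm_eq_zero hw (hloc _ hx), zero_mul]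
    · have := dbar_mul ((hφ z hz w hw).differentiableAt (by simp))
        ((han w hw hx).differentiableAt.restrictScalars ℝ)
      rw [dbar_eq_zero (han w hw hx).differentiableAt] at this
      simp only [Function.comp_apply] at this
      rw [this, mul_zero, add_zero]
  rw [MeasureTheory.setIntegral_congr_fun z.open_target.measurableSet hd,
    MeasureTheory.setIntegral_eq_integral_of_forall_compl_eq_zero, integral_dbar_eq_zero hG1 hGs]
  intro w hw
  rw [dbar_congr (hG0' w fun h => hw (hsub h)), dbar_const]

end ResidueTheorem

/-! ### Bump functions on the surface. -/

section Bump

variable {X : Type*} [TopologicalSpace X]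

open Classical in
/-- A cut-off function around `p`, supported in the disc `|z - z(p)| ≤ r` of a coordinate `z`. -/
noncomputable def surfaceBump (z : OpenPartialHomeomorph X ℂ) (p : X) (r : ℝ) (x : X) : ℂ :=
  if x ∈ z.source then radialCutoff (r ^ 2 / 4) (r ^ 2) (z x - z p) else 0

/-- The disc `|z - z(p)| ≤ r`. -/
def coordDisc (z : OpenPartialHomeomorph X ℂ) (p : X) (r : ℝ) : Set X :=
  z.symm '' Metric.closedBall (z p) r

variable {z : OpenPartialHomeomorph X ℂ} {p : X} {r : ℝ}

theorem isCompact_coordDisc (hr : Metric.closedBall (z p) r ⊆ z.target) :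
    IsCompact (coordDisc z p r) :=
  (isCompact_closedBall _ _).image_of_continuousOn (z.continuousOn_symm.mono hr)

theorem coordDisc_subset_source (hr : Metric.closedBall (z p) r ⊆ z.target) :
    coordDisc z p r ⊆ z.source := by
  rintro _ ⟨w, hw, rfl⟩
  exact z.map_target (hr hw)

theorem surfaceBump_eq_zero (h0 : 0 < r) {x : X} (hx : x ∉ coordDisc z p r) :
    surfaceBump z p r x = 0 := by
  by_cases hxs : x ∈ z.source
  · rw [surfaceBump, if_pos hxs, radialCutoff_eq_zero (by nlinarith)]
    by_contra! hlt
    rw [Complex.normSq_eq_norm_sq] at hlt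
    refine hx ⟨z x, ?_, z.left_inv hxs⟩
    rw [mem_closedBall_iff_norm]
    exact (lt_of_pow_lt_pow_left₀ 2 h0.le hlt).le
  · rw [surfaceBump, if_neg hxs]

theorem surfaceBump_eventually_eq_one (h0 : 0 < r) (hp : p ∈ z.source) :
    ∀ᶠ x in 𝓝 p, surfaceBump z p r x = 1 := by
  have h : ∀ᶠ x in 𝓝 p, z x ∈ Metric.ball (z p) (r / 2) :=
    (z.continuousAt hp).eventually (Metric.ball_mem_nhds _ (by linarith))
  filter_upwards [h, z.open_source.mem_nhds hp] with x hx hxs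
  rw [surfaceBump, if_pos hxs, radialCutoff_eq_one (by nlinarith)]
  rw [mem_ball_iff_norm] at hx
  rw [Complex.normSq_eq_norm_sq]
  nlinarith [norm_nonneg (z x - z p)]

/-- Used to keep a finite sum of bumps away from zero wherever one of them equals 1. -/
theorem surfaceBump_nonneg (z : OpenPartialHomeomorph X ℂ) (p : X) (r : ℝ) (x : X) :
    0 ≤ (surfaceBump z p r x).re := by
  unfold surfaceBump
  split_ifs
  · simpa [radialCutoff] using Real.smoothTransition.nonneg _
  · simp

theorem surfaceBump_comp_symm {w : ℂ} (hw : w ∈ z.target) (hp : z p = 0) :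
    surfaceBump z p r (z.symm w) = radialCutoff (r ^ 2 / 4) (r ^ 2) w := by
  rw [surfaceBump, if_pos (z.map_target hw), z.right_inv hw, hp, sub_zero]

/-- Inside the coordinate domain this is a smooth function of an analytic transition map. At any
other point the bump vanishes nearby, because the disc is compact and hence closed. -/
theorem isC1_surfaceBump [ChartedSpace ℂ X] [T2Space X]
    (hz : z ∈ IsManifold.maximalAtlas 𝓘(ℂ) ω X) (h0 : 0 < r)
    (hr : Metric.closedBall (z p) r ⊆ z.target) : IsC1 (surfaceBump z p r) := by
  intro z' hz' w hw
  by_cases hx : z'.symm w ∈ z.source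
  · have h : ContDiffAt ℝ 1 (fun v => radialCutoff (r ^ 2 / 4) (r ^ 2) ((z ∘ z'.symm) v - z p)) w :=
      (contDiff_radialCutoff _ _).contDiffAt.comp w
        (((analyticAt_transition hz' hz hw hx).contDiffAt.restrict_scalars ℝ).sub
          contDiffAt_const)
    refine h.congr_of_eventuallyEq ?_
    filter_upwards [(isOpen_transition z' z).mem_nhds ⟨hw, hx⟩] with v hv
    rw [Function.comp_apply, surfaceBump, if_pos (show z'.symm v ∈ z.source from hv.2)]
    rfl
  · have hn : (coordDisc z p r)ᶜ ∈ 𝓝 (z'.symm w) :=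
      (isCompact_coordDisc hr).isClosed.isOpen_compl.mem_nhds
        fun h => hx (coordDisc_subset_source hr h)
    refine (contDiffAt_const (c := (0 : ℂ))).congr_of_eventuallyEq ?_
    filter_upwards [eventually_symm_of_eventually hw hn] with v hv
    exact surfaceBump_eq_zero h0 hv

theorem exists_closedBall_subset_target (hp : p ∈ z.source) {U : Set X} (hU : U ∈ 𝓝 p) :
    ∃ R > 0, Metric.closedBall (z p) R ⊆ z.target ∧ coordDisc z p R ⊆ U := by
  have h : z.target ∩ z.symm ⁻¹' U ∈ 𝓝 (z p) :=
    inter_mem (z.open_target.mem_nhds (z.map_source hp))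
      ((z.continuousAt_symm (z.map_source hp)).preimage_mem_nhds (by rwa [z.left_inv hp]))
  obtain ⟨R, hR, hsub⟩ := Metric.nhds_basis_closedBall.mem_iff.1 h
  refine ⟨R, hR, fun w hw => (hsub hw).1, ?_⟩
  rintro _ ⟨w, hw, rfl⟩
  exact (hsub hw).2

end Bump

/-! ### The residue theorem on a compact Riemann surface. -/

section ResidueTheorem

variable {X : Type*} [TopologicalSpace X] [ChartedSpace ℂ X]

/-- The coordinate is centred at p, so the bump is a radial cut-off, and p is the only possible
singular point in the disc. The constant is i · 2πi = -2π. Radius R/2 keeps the cut-off strictly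
inside the disc of radius R. -/
theorem integral_dbarCoeff_surfaceBump {z : OpenPartialHomeomorph X ℂ} {p : X} {R : ℝ}
    (hz : IsCoord z p) (hR : 0 < R) (hRt : Metric.closedBall (z p) R ⊆ z.target) {S : Set X}
    (hS : IsClosed S) (hSp : coordDisc z p R ∩ S ⊆ {p}) {f h : X → ℂ}
    (hf : ∀ x ∉ S, MDifferentiableAt 𝓘(ℂ) 𝓘(ℂ) f x)
    (hh : ∀ x ∉ S, MDifferentiableAt 𝓘(ℂ) 𝓘(ℂ) h x) :
    ∫ w in z.target, dbarCoeff z (surfaceBump z p (R / 2)) f h w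
      = -2 * Real.pi * residueAtZero (diffCoeff z f h) := by
  obtain ⟨hzm, hps, hp0⟩ := hz
  rw [hp0] at hRt
  have hd : ∀ w ∈ Metric.ball (0 : ℂ) R \ {0}, DifferentiableAt ℂ (diffCoeff z f h) w := by
    intro w hw
    have hwt := hRt (Metric.ball_subset_closedBall hw.1)
    have hx : z.symm w ∉ S := by
      intro hS
      have : z.symm w = p := hSp ⟨⟨w, by rw [hp0]; exact Metric.ball_subset_closedBall hw.1, rfl⟩, hS⟩
      apply hw.2
      rw [Set.mem_singleton_iff, ← hp0, ← this, z.right_inv hwt]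
    have hn : Sᶜ ∈ 𝓝 (z.symm w) := hS.isOpen_compl.mem_nhds hx
    exact (analyticAt_diffCoeff hzm hwt (mem_of_superset hn hf)
      (mem_of_superset hn hh)).differentiableAt
  have hdo : DifferentiableOn ℂ (diffCoeff z f h) (Metric.ball 0 R \ {0}) := fun w hw =>
    (hd w hw).differentiableWithinAt
  have key := integral_dbar_radialCutoff_mul (a := (R / 2) ^ 2 / 4) (b := (R / 2) ^ 2)
    (by positivity) (by nlinarith) (by nlinarith) hR hdo.continuousOn
    (fun r hr hrR => circleIntegral_eq_residueAtZero hdo hr hrR)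
  have e : ∀ w ∈ z.target, dbarCoeff z (surfaceBump z p (R / 2)) f h w
      = dbar (radialCutoff ((R / 2) ^ 2 / 4) ((R / 2) ^ 2)) w * diffCoeff z f h w := by
    intro w hw
    rw [dbarCoeff, dbar_congr]
    filter_upwards [z.open_target.mem_nhds hw] with v hv
    exact surfaceBump_comp_symm hv hp0
  rw [MeasureTheory.setIntegral_congr_fun z.open_target.measurableSet e,
    MeasureTheory.setIntegral_eq_integral_of_forall_compl_eq_zero, key]
  · linear_combination (2 * Real.pi * residueAtZero (diffCoeff z f h)) * Complex.I_mul_I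
  · intro w hw
    have hn : (Metric.closedBall (0 : ℂ) (R / 2))ᶜ ∈ 𝓝 w :=
      Metric.isClosed_closedBall.isOpen_compl.mem_nhds fun h =>
        hw (hRt (Metric.closedBall_subset_closedBall (by linarith) h))
    rw [dbar_congr (h := fun _ => 0), dbar_const, zero_mul]
    filter_upwards [hn] with v hv
    apply radialCutoff_eq_zero (by nlinarith)
    rw [Set.mem_compl_iff, mem_closedBall_zero_iff, not_le] at hv
    rw [Complex.normSq_eq_norm_sq]
    nlinarith

/-- **Residue theorem**: the sum of the residues of `f dh` on a compact Riemann surface is zero,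
for functions `f` and `h` which are holomorphic outside a finite set. -/
theorem sum_residueAtZero_diffCoeff_eq_zero [T2Space X] [CompactSpace X]
    [IsManifold 𝓘(ℂ) ω X]
    {ι : Type*} [Fintype ι] {p : ι → X} (hp : Function.Injective p)
    {z : ι → OpenPartialHomeomorph X ℂ} (hz : ∀ i, IsCoord (z i) (p i)) {f h : X → ℂ}
    (hf : ∀ x ∉ Set.range p, MDifferentiableAt 𝓘(ℂ) 𝓘(ℂ) f x)
    (hh : ∀ x ∉ Set.range p, MDifferentiableAt 𝓘(ℂ) 𝓘(ℂ) h x) :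
    ∑ i, residueAtZero (diffCoeff (z i) f h) = 0 := by
  classical
  have hS : IsClosed (Set.range p) := (Set.finite_range p).isClosed
  -- The disc around `p i` is chosen to miss all the other `p j`.
  have hU : ∀ i, (p '' {i}ᶜ)ᶜ ∈ 𝓝 (p i) := fun i =>
    (Set.toFinite _).isClosed.isOpen_compl.mem_nhds (by
      rintro ⟨j, hj, hji⟩
      exact hj (hp hji))
  choose R hR hRt hRU using fun i => exists_closedBall_subset_target (hz i).2.1 (hU i)
  choose r hr hrt _ using fun x : X =>
    exists_closedBall_subset_target (mem_chart_source ℂ x) (U := Set.univ) univ_mem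
  -- By compactness, finitely many chart bumps suffice for one of them to equal 1 at every point.
  obtain ⟨t, ht⟩ := CompactSpace.elim_nhds_subcover
    (fun x : X => {y | surfaceBump (chartAt ℂ x) x (r x) y = 1})
    fun x => surfaceBump_eventually_eq_one (hr x) (mem_chart_source ℂ x)
  have hR2 : ∀ i, Metric.closedBall (z i (p i)) (R i / 2) ⊆ (z i).target := fun i =>
    (Metric.closedBall_subset_closedBall (by linarith [hR i])).trans (hRt i)
  have hdisc : ∀ i, coordDisc (z i) (p i) (R i / 2) ⊆ coordDisc (z i) (p i) (R i) := fun i =>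
    Set.image_mono (Metric.closedBall_subset_closedBall (by linarith [hR i]))
  set b : ι → X → ℂ := fun i => surfaceBump (z i) (p i) (R i / 2) with hb
  set u : X → ℂ := fun x => 1 - ∑ i, b i x with hu
  set c : t → X → ℂ := fun j => surfaceBump (chartAt ℂ (j : X)) j (r j) with hc
  set B : X → ℂ := fun x => ∑ j, c j x with hB
  have hB0 : ∀ x, B x ≠ 0 := by
    intro x hx
    have hx' : x ∈ (⋃ y ∈ t, {y' | surfaceBump (chartAt ℂ y) y (r y) y' = 1} : Set X) := by
      rw [ht]; trivial
    simp only [Set.mem_iUnion] at hx'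
    obtain ⟨y, hy, hyx⟩ := hx'
    have h1 : (c ⟨y, hy⟩ x).re = 1 := by
      have : c ⟨y, hy⟩ x = 1 := hyx
      rw [this, Complex.one_re]
    have h2 : (c ⟨y, hy⟩ x).re ≤ (B x).re := by
      rw [hB, Complex.re_sum]
      exact Finset.single_le_sum (f := fun j => (c j x).re)
        (fun j _ => surfaceBump_nonneg _ _ _ _) (Finset.mem_univ _)
    rw [h1, hx] at h2
    norm_num at h2
  have hbC : ∀ i, IsC1 (b i) := fun i =>
    isC1_surfaceBump (hz i).1 (half_pos (hR i)) (hR2 i)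
  have hcC : ∀ j, IsC1 (c j) := fun j =>
    isC1_surfaceBump (IsManifold.chart_mem_maximalAtlas _) (hr j) (hrt j)
  have huC : IsC1 u := (IsC1.sum fun i _ => hbC i).const_sub 1
  have hBC : IsC1 B := IsC1.sum fun j _ => hcC j
  have hbloc : ∀ i k, ∀ᶠ y in 𝓝 (p k), b i y = if i = k then 1 else 0 := by
    intro i k
    by_cases hik : i = k
    · subst hik
      simpa using surfaceBump_eventually_eq_one (half_pos (hR i)) (hz i).2.1
    · have hn : (coordDisc (z i) (p i) (R i / 2))ᶜ ∈ 𝓝 (p k) :=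
        (isCompact_coordDisc (hR2 i)).isClosed.isOpen_compl.mem_nhds fun h =>
          hRU i (hdisc i h) ⟨k, fun h' => hik h'.symm, rfl⟩
      filter_upwards [hn] with y hy
      rw [if_neg hik]
      exact surfaceBump_eq_zero (half_pos (hR i)) hy
  have huloc : ∀ k, ∀ᶠ y in 𝓝 (p k), u y = 0 := by
    intro k
    filter_upwards [eventually_all.2 fun i => hbloc i k] with y hy
    simp [hu, hy]
  -- The partition of unity: the sum is ∑ b_i + u ∑ c_j / B = ∑ b_i + u = 1. The factor u kills the
  -- second family near every `p k`.
  set φ : ι ⊕ t → X → ℂ := Sum.elim b fun j x => u x * (c j x / B x) with hφ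
  set Z : ι ⊕ t → OpenPartialHomeomorph X ℂ := Sum.elim z fun j => chartAt ℂ (j : X) with hZ
  set K : ι ⊕ t → Set X := Sum.elim (fun i => coordDisc (z i) (p i) (R i / 2))
    fun j => coordDisc (chartAt ℂ (j : X)) j (r j) with hK
  have hφr : ∀ j : t, IsC1 (φ (Sum.inr j)) := fun j => huC.mul ((hcC j).div hBC hB0)
  have hφr0 : ∀ j : t, ∀ x ∉ K (Sum.inr j), φ (Sum.inr j) x = 0 := by
    intro j x hx
    have : c j x = 0 := surfaceBump_eq_zero (hr j) hx
    simp [hφ, this]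
  have hφrloc : ∀ j : t, ∀ x ∈ Set.range p, ∀ᶠ y in 𝓝 x, φ (Sum.inr j) y = 0 := by
    rintro j _ ⟨k, rfl⟩
    filter_upwards [huloc k] with y hy
    simp [hφ, hy]
  have hZm : ∀ i, Z i ∈ IsManifold.maximalAtlas 𝓘(ℂ) ω X := by
    rintro (i | j)
    · exact (hz i).1
    · exact IsManifold.chart_mem_maximalAtlas _
  have hKc : ∀ i, IsCompact (K i) := by
    rintro (i | j)
    · exact isCompact_coordDisc (hR2 i)
    · exact isCompact_coordDisc (hrt j)
  have hKZ : ∀ i, K i ⊆ (Z i).source := by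
    rintro (i | j)
    · exact coordDisc_subset_source (hR2 i)
    · exact coordDisc_subset_source (hrt j)
  have htot := sum_integral_dbarCoeff_eq_zero (z := Z) hZm (φ := φ)
    (by rintro (i | j); exacts [hbC i, hφr j]) (K := K) hKc hKZ
    (by
      rintro (i | j)
      · exact fun x hx => surfaceBump_eq_zero (half_pos (hR i)) hx
      · exact hφr0 j)
    (by
      intro x
      rw [Fintype.sum_sum_type]
      simp only [hφ, Sum.elim_inl, Sum.elim_inr]
      rw [← Finset.mul_sum, ← Finset.sum_div, div_self (hB0 x)]
      simp [hu]) hS hf hh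
    (by
      rintro (i | j) x hx
      · obtain ⟨k, rfl⟩ := hx
        exact ⟨_, hbloc i k⟩
      · exact ⟨0, hφrloc j x hx⟩)
  rw [Fintype.sum_sum_type] at htot
  have hr0 : ∀ j : t, ∫ w in (Z (Sum.inr j)).target,
      dbarCoeff (Z (Sum.inr j)) (φ (Sum.inr j)) f h w = 0 := fun j =>
    integral_dbarCoeff_eq_zero (hZm _) (hφr j) hS hf hh (hφrloc j) (hKc _) (hKZ _) (hφr0 j)
  have hl : ∀ i, ∫ w in (Z (Sum.inl i)).target,
      dbarCoeff (Z (Sum.inl i)) (φ (Sum.inl i)) f h w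
        = -2 * Real.pi * residueAtZero (diffCoeff (z i) f h) := fun i =>
    integral_dbarCoeff_surfaceBump (hz i) (hR i) (hRt i) hS (by
      rintro _ ⟨hx, k, rfl⟩
      by_contra hne
      exact hRU i hx ⟨k, fun h' => hne (by rw [Set.mem_singleton_iff.1 h']; rfl), rfl⟩) hf hh
  simp only [hr0, hl, Finset.sum_const_zero, add_zero, ← Finset.mul_sum] at htot
  refine (mul_eq_zero.1 htot).resolve_left ?_
  simp [Real.pi_ne_zero]

end ResidueTheorem

/-! ### Orders -/

theorem IsOPow.mono {F : ℂ → ℂ} {k l : ℤ} (h : IsOPow F l) (hkl : k ≤ l) : IsOPow F k := by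
  refine Asymptotics.IsBigO.trans h ?_
  refine Asymptotics.IsBigO.of_bound 1 ?_
  have hb : ∀ᶠ w : ℂ in 𝓝[≠] 0, w ∈ Metric.ball (0 : ℂ) 1 :=
    mem_nhdsWithin_of_mem_nhds (Metric.ball_mem_nhds _ one_pos)
  filter_upwards [hb, self_mem_nhdsWithin] with w hw hw0
  rw [one_mul, norm_zpow, norm_zpow]
  exact zpow_le_zpow_right_of_le_one₀ (norm_pos_iff.2 hw0) (mem_ball_zero_iff.1 hw).le hkl

theorem IsOPow.congr {F G : ℂ → ℂ} {k : ℤ} (h : IsOPow F k) (e : F =ᶠ[𝓝[≠] 0] G) :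
    IsOPow G k :=
  Asymptotics.IsBigO.congr' h e .rfl

theorem IsOPow.add {F G : ℂ → ℂ} {k : ℤ} (h : IsOPow F k) (h' : IsOPow G k) :
    IsOPow (fun w => F w + G w) k :=
  Asymptotics.IsBigO.add h h'

theorem isOPow_zpow_mul (k : ℤ) (c : ℂ) : IsOPow (fun w => w ^ k * c) k := by
  simp only [mul_comm _ c]
  exact (Asymptotics.isBigO_refl _ _).const_mul_left c

theorem IsMatOPow.trace {N : ℕ} {F : ℂ → Matrix (Fin N) (Fin N) ℂ} {k : ℤ}
    (h : IsMatOPow F k) : IsOPow (fun w => (F w).trace) k :=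
  Asymptotics.IsBigO.fun_sum (A := fun i w => F w i i) fun i _ => h i i

theorem IsMatOPow.of_sub_zpow_smul {N : ℕ} {F : ℂ → Matrix (Fin N) (Fin N) ℂ} {k : ℤ}
    {Y : Matrix (Fin N) (Fin N) ℂ} (h : IsMatOPow (fun w => F w - w ^ k • Y) (k + 1)) :
    IsMatOPow F k := by
  intro i j
  have := ((h i j).mono (by omega : k ≤ k + 1)).add (isOPow_zpow_mul k (Y i j))
  refine this.congr (Eventually.of_forall fun w => ?_)
  simp

theorem IsOPow.of_sub_zpow {F : ℂ → ℂ} {k : ℤ} (h : IsOPow (fun w => F w - w ^ k) (k + 1)) :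
    IsOPow F k := by
  have := (h.mono (by omega : k ≤ k + 1)).add (isOPow_zpow_mul k 1)
  refine this.congr (Eventually.of_forall fun w => ?_)
  simp

/-! ### Traces at the weak singularities -/

/-- The relation reads X = -σ⁻¹Xᵗσ, whence tr X = -tr X. -/
theorem trace_eq_zero_of_mem_skewAdjoint {N : ℕ} {σ X : Matrix (Fin N) (Fin N) ℂ}
    (hσ : IsUnit σ.det) (hX : X ∈ skewAdjointMatricesSubmodule σ) : X.trace = 0 := by
  rw [mem_skewAdjointMatricesSubmodule, Matrix.IsSkewAdjoint, Matrix.IsAdjointPair] at hX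
  have h1 : X = -(σ⁻¹ * (Xᵀ * σ)) := by
    rw [hX, mul_neg, mul_neg, neg_neg, ← mul_assoc, Matrix.nonsing_inv_mul _ hσ, one_mul]
  have h2 : (σ⁻¹ * (Xᵀ * σ)).trace = X.trace := by
    rw [Matrix.trace_mul_comm, mul_assoc, Matrix.mul_nonsing_inv _ hσ, mul_one,
      Matrix.trace_transpose]
  have h3 := congrArg Matrix.trace h1
  rw [Matrix.trace_neg, h2] at h3
  linear_combination h3 / 2

/-- The residue αβᵗ has trace βᵗα = 0, so only the regular part contributes. -/
theorem GLWeak.isOPow_trace {N : ℕ} {α : Fin N → ℂ} {F : ℂ → Matrix (Fin N) (Fin N) ℂ}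
    (h : GLWeak α F) : IsOPow (fun w => (F w).trace) 0 := by
  obtain ⟨β, κ, L₀, h1, -, h3⟩ := h
  have := (h3.trace.mono (by omega : (0 : ℤ) ≤ 1)).add (isOPow_zpow_mul 0 L₀.trace)
  refine this.congr (Eventually.of_forall fun w => ?_)
  have h0 : α ⬝ᵥ β = 0 := by rw [dotProduct_comm, h1]
  simp [Matrix.trace_vecMulVec, h0]

/-- For `so` and `sp` membership in the algebra already gives trace zero, so their expansions, with
the double pole for `sp`, need not be examined. -/
theorem MatAlg.WeakCond.isOPow_trace {n N : ℕ} {A : MatAlg n N} {α : Fin N → ℂ}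
    {F : ℂ → Matrix (Fin N) (Fin N) ℂ} (h : A.WeakCond α F) (hF : ∀ w, F w ∈ A.carrier) :
    IsOPow (fun w => (F w).trace) 0 := by
  have h0 : (∀ w, (F w).trace = 0) → IsOPow (fun w => (F w).trace) 0 := fun h => by
    simp only [h]
    exact Asymptotics.isBigO_zero _ _
  cases A with
  | gl => exact GLWeak.isOPow_trace h
  | sl => exact GLWeak.isOPow_trace h
  | so => exact h0 fun w => trace_eq_zero_of_mem_skewAdjoint (by simp) (hF w)
  | s => exact GLWeak.isOPow_trace h
  | sp σ _ hσ => exact h0 fun w => trace_eq_zero_of_mem_skewAdjoint hσ (hF w)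

/-! ### Forms and vector fields in local coordinates -/

section Coordinates

variable {X : Type*} [TopologicalSpace X]

theorem diffCoeff_congr {z : OpenPartialHomeomorph X ℂ} {f f' h h' : X → ℂ}
    (hf : f ∘ z.symm =ᶠ[𝓝[≠] 0] f' ∘ z.symm) (hh : h ∘ z.symm =ᶠ[𝓝[≠] 0] h' ∘ z.symm) :
    diffCoeff z f h =ᶠ[𝓝[≠] 0] diffCoeff z f' h' := by
  filter_upwards [hf, hh.nhdsNE_deriv] with w h1 h2
  simp only [Function.comp_apply] at h1
  rw [diffCoeff, diffCoeff, h1, h2]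

theorem meromorphicAt_diffCoeff {z : OpenPartialHomeomorph X ℂ} {f h : X → ℂ}
    (hf : MeromorphicAt (f ∘ z.symm) 0) (hh : MeromorphicAt (h ∘ z.symm) 0) :
    MeromorphicAt (diffCoeff z f h) 0 :=
  hf.mul hh.deriv

variable [ChartedSpace ℂ X]

theorem IsCoord.zero_mem_target {z : OpenPartialHomeomorph X ℂ} {p : X} (hz : IsCoord z p) :
    (0 : ℂ) ∈ z.target := hz.2.2 ▸ z.map_source hz.2.1

theorem IsCoord.symm_zero {z : OpenPartialHomeomorph X ℂ} {p : X} (hz : IsCoord z p) :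
    z.symm 0 = p := hz.2.2 ▸ z.left_inv hz.2.1

/-- Near the centre of a coordinate, but not at the centre, a finite set of points is avoided. -/
theorem IsCoord.eventually_notMem [T2Space X] {z : OpenPartialHomeomorph X ℂ} {p : X}
    (hz : IsCoord z p) {S : Set X} (hS : S.Finite) :
    ∀ᶠ w in 𝓝[≠] (0 : ℂ), w ∈ z.target ∧ z.symm w ∉ S := by
  have h1 : (S \ {p})ᶜ ∈ 𝓝 (z.symm 0) :=
    (hS.sdiff).isClosed.isOpen_compl.mem_nhds (by simp [hz.symm_zero])
  have h2 := eventually_symm_of_eventually hz.zero_mem_target h1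
  filter_upwards [h2.filter_mono nhdsWithin_le_nhds, self_mem_nhdsWithin,
    mem_nhdsWithin_of_mem_nhds (z.open_target.mem_nhds hz.zero_mem_target)] with w hw hw0 hwt
  refine ⟨hwt, fun h => hw ⟨h, fun hp => hw0 ?_⟩⟩
  rw [Set.mem_singleton_iff, ← hz.2.2, ← Set.mem_singleton_iff.1 hp, z.right_inv hwt]

theorem dfun_coordVec {z : OpenPartialHomeomorph X ℂ}
    (hz : z ∈ IsManifold.maximalAtlas 𝓘(ℂ) ω X) {f : X → ℂ} {w : ℂ} (hw : w ∈ z.target)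
    (hf : MDifferentiableAt 𝓘(ℂ) 𝓘(ℂ) f (z.symm w)) :
    dfun f (z.symm w) (coordVec z w) = deriv (f ∘ z.symm) w := by
  have h := mfderiv_comp_apply w hf
    ((mdifferentiable_of_mem_maximalAtlas hz).mdifferentiableAt_symm hw) (1 : ℂ)
  rw [mfderiv_eq_fderiv] at h
  exact h.symm

/-- The differential of z followed by that of its inverse is the identity, and the coordinate line ℂ
is spanned by 1. -/
theorem eq_fieldCoeff_smul_coordVec {z : OpenPartialHomeomorph X ℂ}
    (hz : z ∈ IsManifold.maximalAtlas 𝓘(ℂ) ω X) (e : VField X) {w : ℂ} (hw : w ∈ z.target) :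
    e (z.symm w) = fieldCoeff z e w • coordVec z w := by
  have h := (mdifferentiable_of_mem_maximalAtlas hz).symm_comp_deriv (z.map_target hw)
  have h2 := DFunLike.congr_fun h (e (z.symm w))
  rw [z.right_inv hw] at h2
  have h3 : mfderiv 𝓘(ℂ) 𝓘(ℂ) z.symm w (fieldCoeff z e w) = e (z.symm w) := h2
  have h4 := (mfderiv 𝓘(ℂ) 𝓘(ℂ) z.symm w).map_smul (fieldCoeff z e w) (1 : ℂ)
  rw [← h3]
  refine Eq.trans ?_ h4
  congr 1
  exact (mul_one (fieldCoeff z e w)).symm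

theorem formCoeff_traceForm {N : ℕ} {z : OpenPartialHomeomorph X ℂ}
    (hz : z ∈ IsManifold.maximalAtlas 𝓘(ℂ) ω X) (L : X → Matrix (Fin N) (Fin N) ℂ)
    {L' : X → Matrix (Fin N) (Fin N) ℂ} {w : ℂ} (hw : w ∈ z.target)
    (hL' : ∀ i, MDifferentiableAt 𝓘(ℂ) 𝓘(ℂ) (fun y => L' y i i) (z.symm w)) :
    formCoeff z (traceForm L L') w
      = diffCoeff z (fun x => (L x).trace) (fun x => (L' x).trace) w := by
  have h1 : formCoeff z (traceForm L L') w
      = (L (z.symm w)).trace * ∑ i, dfun (fun y => L' y i i) (z.symm w) (coordVec z w) := by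
    simp only [formCoeff, traceForm]
    rw [smul_apply, sum_apply, smul_eq_mul]
  rw [h1, diffCoeff]
  congr 1
  simp only [dfun_coordVec hz hw (hL' _)]
  have h2 : (fun x => (L' x).trace) ∘ z.symm
      = fun v => ∑ i, ((fun y => L' y i i) ∘ z.symm) v := rfl
  rw [h2, deriv_fun_sum fun i _ => differentiableAt_comp_symm hz hw (hL' i)]

/-- The transition map is analytic and fixes 0. This passes from the fixed coordinates at P₊ and P₋
to arbitrary ones. -/
theorem IsCoord.meromorphicAt_of_meromorphicAt {z z' : OpenPartialHomeomorph X ℂ} {p : X}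
    (hz : IsCoord z p) (hz' : IsCoord z' p) {f : X → ℂ}
    (hf : MeromorphicAt (f ∘ z'.symm) 0) : MeromorphicAt (f ∘ z.symm) 0 := by
  have hs : z.symm 0 ∈ z'.source := by rw [hz.symm_zero]; exact hz'.2.1
  have h1 := analyticAt_transition hz.1 hz'.1 hz.zero_mem_target hs
  have h2 : (z' ∘ z.symm) 0 = 0 := by simp [hz.symm_zero, hz'.2.2]
  have h3 : MeromorphicAt ((f ∘ z'.symm) ∘ (z' ∘ z.symm)) 0 :=
    MeromorphicAt.comp_analyticAt (by rwa [h2]) h1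
  refine h3.congr (Filter.Eventually.filter_mono nhdsWithin_le_nhds ?_)
  filter_upwards [(isOpen_transition z z').mem_nhds ⟨hz.zero_mem_target, hs⟩] with v hv
  simp [z'.left_inv hv.2]

end Coordinates

variable {X : Type*} [TopologicalSpace X] [ChartedSpace ℂ X] {n N : ℕ} {A : MatAlg n N}

/-! ### Traces of Lax operators as functions on the surface. -/

namespace LaxData

variable (D : LaxData X A)

theorem finite_marked : D.marked.Finite := (Set.finite_range _).union (Set.toFinite _)

/-- The part of the definition of a Lax operator which concerns its trace. -/
structure TraceRegular (L : X → Matrix (Fin N) (Fin N) ℂ) : Prop where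
  mdifferentiableAt : ∀ x ∉ D.marked, ∀ i, MDifferentiableAt 𝓘(ℂ) 𝓘(ℂ) (fun y => L y i i) x
  isOPow : ∀ s, IsOPow (fun w => (L ((D.z s).symm w)).trace) 0
  mero_Pp : MeromorphicAt ((fun x => (L x).trace) ∘ D.zp.symm) 0
  mero_Pm : MeromorphicAt ((fun x => (L x).trace) ∘ D.zm.symm) 0

variable {D}

theorem meromorphicAt_trace {F : ℂ → Matrix (Fin N) (Fin N) ℂ}
    (h : ∀ i, MeromorphicAt (fun w => F w i i) 0) : MeromorphicAt (fun w => (F w).trace) 0 :=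
  MeromorphicAt.fun_sum fun i _ => h i

theorem traceRegular_of_mem {L : X → Matrix (Fin N) (Fin N) ℂ} (h : L ∈ D.laxAlgebra) :
    D.TraceRegular L where
  mdifferentiableAt x hx i := h.2.2.1 x hx i i
  isOPow s := (h.2.2.2.2.2 s).isOPow_trace fun _ => h.2.1 _
  mero_Pp := meromorphicAt_trace fun i => h.2.2.2.1 i i
  mero_Pm := meromorphicAt_trace fun i => h.2.2.2.2.1 i i

theorem TraceRegular.add {L M : X → Matrix (Fin N) (Fin N) ℂ} (h : D.TraceRegular L)
    (h' : D.TraceRegular M) : D.TraceRegular (L + M) where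
  mdifferentiableAt x hx i := (h.mdifferentiableAt x hx i).add (h'.mdifferentiableAt x hx i)
  isOPow s := ((h.isOPow s).add (h'.isOPow s)).congr
    (Eventually.of_forall fun _ => by simp [Matrix.trace_add])
  mero_Pp := (h.mero_Pp.add h'.mero_Pp).congr
    (Eventually.of_forall fun _ => by simp [Matrix.trace_add])
  mero_Pm := (h.mero_Pm.add h'.mero_Pm).congr
    (Eventually.of_forall fun _ => by simp [Matrix.trace_add])

theorem TraceRegular.mdifferentiableAt_trace {L : X → Matrix (Fin N) (Fin N) ℂ}
    (h : D.TraceRegular L) {x : X} (hx : x ∉ D.marked) :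
    MDifferentiableAt 𝓘(ℂ) 𝓘(ℂ) (fun y => (L y).trace) x := by
  have e : (fun y => (L y).trace) = ∑ i, fun y => L y i i := by
    funext y
    simp [Matrix.trace]
  rw [e]
  exact MDifferentiableAt.sum fun i _ => h.mdifferentiableAt x hx i

variable [T2Space X]

theorem eventually_notMem_marked (D : LaxData X A) {z : OpenPartialHomeomorph X ℂ} {p : X}
    (hz : IsCoord z p) : ∀ᶠ w in 𝓝[≠] (0 : ℂ), w ∈ z.target ∧ z.symm w ∉ D.marked :=
  hz.eventually_notMem D.finite_marked

/-- The singularities of the trace at the points `γ_s` are removable. -/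
theorem TraceRegular.exists_extension {L : X → Matrix (Fin N) (Fin N) ℂ}
    (h : D.TraceRegular L) : ∃ f : X → ℂ, (∀ x ∉ D.marked, f x = (L x).trace) ∧
      ∀ x, x ≠ D.Pp → x ≠ D.Pm → MDifferentiableAt 𝓘(ℂ) 𝓘(ℂ) f x := by
  classical
  have hdiff : ∀ s, ∀ᶠ w in 𝓝[≠] (0 : ℂ),
      DifferentiableAt ℂ ((fun x => (L x).trace) ∘ (D.z s).symm) w := by
    intro s
    filter_upwards [D.eventually_notMem_marked (D.z_coord s)] with w hw
    exact differentiableAt_comp_symm (D.z_coord s).1 hw.1 (h.mdifferentiableAt_trace hw.2)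
  have hc : ∀ s, ∃ c, DifferentiableAt ℂ
      (Function.update ((fun x => (L x).trace) ∘ (D.z s).symm) 0 c) 0 := by
    intro s
    -- The removable singularity theorem is used in the form F - F(0) = o(1/w); here F(0) is merely
    -- the value stored at the centre.
    have hb : IsOPow (fun w => ((fun x => (L x).trace) ∘ (D.z s).symm) w
        - ((fun x => (L x).trace) ∘ (D.z s).symm) 0) 0 := by
      refine ((h.isOPow s).add (isOPow_zpow_mul 0
        (-((fun x => (L x).trace) ∘ (D.z s).symm) 0))).congr (Eventually.of_forall fun w => ?_)
      simp [sub_eq_add_neg]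
    simp only [IsOPow, zpow_zero] at hb
    refine ⟨_, (Complex.differentiableOn_update_limUnder_insert_of_isLittleO (hdiff s)
      (fun w hw => DifferentiableAt.differentiableWithinAt hw)
      (IsBoundedUnder.isLittleO_sub_self_inv
        ((Asymptotics.isBigO_one_iff ℂ).1 hb))).differentiableAt
      (insert_mem_nhds_iff.2 (hdiff s))⟩
  choose c hc using hc
  -- Only the values at the γ_s are changed. Injectivity of `D.pt` identifies the index picked by
  -- `choose`.
  refine ⟨fun x => if hx : ∃ s, D.pt s = x then c hx.choose else (L x).trace, ?_, ?_⟩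
  · intro x hx
    have hx' : ¬ ∃ s, D.pt s = x := fun ⟨s, hs⟩ => hx (Or.inl ⟨s, hs⟩)
    simp only [dif_neg hx']
  · intro x hp hm
    by_cases hx : ∃ s, D.pt s = x
    · obtain ⟨s, rfl⟩ := hx
      apply mdifferentiableAt_of_comp_symm (D.z_coord s).1 (D.z_coord s).2.1
      rw [(D.z_coord s).2.2]
      refine (hc s).congr_of_eventuallyEq ?_
      have hev := eventually_nhdsWithin_iff.1 (D.eventually_notMem_marked (D.z_coord s))
      filter_upwards [hev] with w hw
      by_cases hw0 : w = 0
      · subst hw0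
        have hex : ∃ t, D.pt t = D.pt s := ⟨s, rfl⟩
        have hch : hex.choose = s := D.pt_injective hex.choose_spec
        simp only [Function.comp_apply, (D.z_coord s).symm_zero, Function.update_self]
        rw [dif_pos hex, hch]
      · have hx' : ¬ ∃ t, D.pt t = (D.z s).symm w := fun ⟨t, ht⟩ =>
          (hw hw0).2 (Or.inl ⟨t, ht⟩)
        simp only [Function.comp_apply, Function.update_of_ne hw0]
        rw [dif_neg hx']
    · have hxm : x ∉ D.marked := by
        rintro (h1 | h1 | h1)
        exacts [hx h1, hp h1, hm h1]
      refine (h.mdifferentiableAt_trace hxm).congr_of_eventuallyEq ?_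
      filter_upwards [D.finite_marked.isClosed.isOpen_compl.mem_nhds hxm] with y hy
      have hy' : ¬ ∃ s, D.pt s = y := fun ⟨s, hs⟩ => hy (Or.inl ⟨s, hs⟩)
      rw [dif_neg hy']

/-! ### The form `tr(L) tr(dL')` and its residue at `P₊` -/

theorem formCoeff_traceForm_eventuallyEq (L : X → Matrix (Fin N) (Fin N) ℂ)
    {L' : X → Matrix (Fin N) (Fin N) ℂ} (h' : D.TraceRegular L')
    {z : OpenPartialHomeomorph X ℂ} {p : X} (hz : IsCoord z p) :
    formCoeff z (traceForm L L')
      =ᶠ[𝓝[≠] 0] diffCoeff z (fun x => (L x).trace) fun x => (L' x).trace := by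
  filter_upwards [D.eventually_notMem_marked hz] with w hw
  exact formCoeff_traceForm hz.1 L hw.1 (h'.mdifferentiableAt _ hw.2)

/-- Differentiability near P₊ is all that the residue sees. This version serves ∇_e L', for which
regularity of the trace at the γ_s is not established. -/
theorem gammaTwo_eq_residueAtZero {L L' : X → Matrix (Fin N) (Fin N) ℂ}
    (h' : ∀ᶠ w in 𝓝[≠] (0 : ℂ), ∀ i,
      MDifferentiableAt 𝓘(ℂ) 𝓘(ℂ) (fun y => L' y i i) (D.zp.symm w)) :
    D.gammaTwo L L'
      = residueAtZero (diffCoeff D.zp (fun x => (L x).trace) fun x => (L' x).trace) := by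
  apply residueAtZero_congr
  filter_upwards [h', D.eventually_notMem_marked D.zp_coord] with w h hw
  exact formCoeff_traceForm D.zp_coord.1 L hw.1 h

theorem TraceRegular.gammaTwo_eq (L : X → Matrix (Fin N) (Fin N) ℂ)
    {L' : X → Matrix (Fin N) (Fin N) ℂ} (h' : D.TraceRegular L') :
    D.gammaTwo L L'
      = residueAtZero (diffCoeff D.zp (fun x => (L x).trace) fun x => (L' x).trace) :=
  residueAtZero_congr (formCoeff_traceForm_eventuallyEq L h' D.zp_coord)

theorem comp_symm_eventuallyEq (D : LaxData X A) {z : OpenPartialHomeomorph X ℂ} {p : X}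
    (hz : IsCoord z p) {f g : X → ℂ} (h : ∀ x ∉ D.marked, f x = g x) :
    f ∘ z.symm =ᶠ[𝓝[≠] 0] g ∘ z.symm :=
  (D.eventually_notMem_marked hz).mono fun _ hw => h _ hw.2

/-- At P₊ and P₋ meromorphy is transported from the fixed coordinates; elsewhere the trace agrees,
off the marked points, with its holomorphic extension. -/
theorem TraceRegular.meromorphicAt {L : X → Matrix (Fin N) (Fin N) ℂ} (h : D.TraceRegular L)
    {z : OpenPartialHomeomorph X ℂ} {p : X} (hz : IsCoord z p) :
    MeromorphicAt ((fun x => (L x).trace) ∘ z.symm) 0 ∧ (p ≠ D.Pp → p ≠ D.Pm →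
      ∃ f : X → ℂ, (∀ x ∉ D.marked, f x = (L x).trace) ∧ AnalyticAt ℂ (f ∘ z.symm) 0) := by
  have key : p ≠ D.Pp → p ≠ D.Pm →
      ∃ f : X → ℂ, (∀ x ∉ D.marked, f x = (L x).trace) ∧ AnalyticAt ℂ (f ∘ z.symm) 0 := by
    intro hp hm
    obtain ⟨f, hf, hfd⟩ := h.exists_extension
    refine ⟨f, hf, analyticAt_comp_symm hz.1 hz.zero_mem_target ?_⟩
    rw [hz.symm_zero]
    filter_upwards [isOpen_ne.mem_nhds hp, isOpen_ne.mem_nhds hm] with x h1 h2 using hfd x h1 h2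
  refine ⟨?_, key⟩
  by_cases hp : p = D.Pp
  · subst hp
    exact hz.meromorphicAt_of_meromorphicAt D.zp_coord h.mero_Pp
  by_cases hm : p = D.Pm
  · subst hm
    exact hz.meromorphicAt_of_meromorphicAt D.zm_coord h.mero_Pm
  obtain ⟨f, hf, hfa⟩ := key hp hm
  exact hfa.meromorphicAt.congr (D.comp_symm_eventuallyEq hz hf)

theorem meromorphicAt_formCoeff_traceForm {L L' : X → Matrix (Fin N) (Fin N) ℂ}
    (h : D.TraceRegular L) (h' : D.TraceRegular L') {z : OpenPartialHomeomorph X ℂ} {p : X}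
    (hz : IsCoord z p) :
    MeromorphicAt (formCoeff z (traceForm L L')) 0 ∧ (p ≠ D.Pp → p ≠ D.Pm →
      0 ≤ meromorphicOrderAt (formCoeff z (traceForm L L')) 0) := by
  have e := formCoeff_traceForm_eventuallyEq L h' hz
  refine ⟨(meromorphicAt_diffCoeff (h.meromorphicAt hz).1 (h'.meromorphicAt hz).1).congr e.symm,
    fun hp hm => ?_⟩
  obtain ⟨f, hf, hfa⟩ := (h.meromorphicAt hz).2 hp hm
  obtain ⟨f', hf', hfa'⟩ := (h'.meromorphicAt hz).2 hp hm
  rw [meromorphicOrderAt_congr (e.trans (diffCoeff_congr (D.comp_symm_eventuallyEq hz hf)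
    (D.comp_symm_eventuallyEq hz hf')).symm)]
  exact (hfa.mul hfa'.deriv).meromorphicOrderAt_nonneg

/-! ### The cocycle property -/

/-- The two forms add up to the exact form d(tr L · tr L'). -/
theorem gammaTwo_add_swap {L L' : X → Matrix (Fin N) (Fin N) ℂ} (h : D.TraceRegular L)
    (h' : D.TraceRegular L') : D.gammaTwo L L' + D.gammaTwo L' L = 0 := by
  rw [h'.gammaTwo_eq, h.gammaTwo_eq, ← residueAtZero_add
    (meromorphicAt_diffCoeff h.mero_Pp h'.mero_Pp) (meromorphicAt_diffCoeff h'.mero_Pp h.mero_Pp),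
    ← residueAtZero_deriv (h.mero_Pp.mul h'.mero_Pp)]
  apply residueAtZero_congr
  filter_upwards [h.mero_Pp.eventually_analyticAt, h'.mero_Pp.eventually_analyticAt] with w h1 h2
  rw [deriv_mul h1.differentiableAt h2.differentiableAt]
  simp only [diffCoeff, Function.comp_apply]
  ring

theorem gammaTwo_add_left {L M L' : X → Matrix (Fin N) (Fin N) ℂ} (h : D.TraceRegular L)
    (hM : D.TraceRegular M) (h' : D.TraceRegular L') :
    D.gammaTwo (L + M) L' = D.gammaTwo L L' + D.gammaTwo M L' := by
  rw [h'.gammaTwo_eq, h'.gammaTwo_eq, h'.gammaTwo_eq, ← residueAtZero_add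
    (meromorphicAt_diffCoeff h.mero_Pp h'.mero_Pp) (meromorphicAt_diffCoeff hM.mero_Pp h'.mero_Pp)]
  congr 1
  funext w
  simp only [diffCoeff, Pi.add_apply, Matrix.trace_add]
  ring

theorem gammaTwo_smul_left (c : ℂ) {L L' : X → Matrix (Fin N) (Fin N) ℂ} (h : D.TraceRegular L)
    (h' : D.TraceRegular L') : D.gammaTwo (c • L) L' = c * D.gammaTwo L L' := by
  rw [h'.gammaTwo_eq, h'.gammaTwo_eq, ← residueAtZero_const_mul
    (meromorphicAt_diffCoeff h.mero_Pp h'.mero_Pp)]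
  congr 1
  funext w
  simp only [diffCoeff, Pi.smul_apply, Matrix.trace_smul, smul_eq_mul]
  ring

omit [T2Space X] in
theorem gammaTwo_eq_zero_of_trace_eq_zero {L : X → Matrix (Fin N) (Fin N) ℂ}
    (h : ∀ x, (L x).trace = 0) (L' : X → Matrix (Fin N) (Fin N) ℂ) : D.gammaTwo L L' = 0 := by
  have : formCoeff D.zp (traceForm L L') = fun _ => 0 := by
    funext w
    simp only [formCoeff, traceForm]
    rw [smul_apply, h, zero_smul]
  rw [gammaTwo, this, residueAtZero_zero]

omit [T2Space X] [ChartedSpace ℂ X] [TopologicalSpace X] in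
theorem trace_lie (P Q : Matrix (Fin N) (Fin N) ℂ) :
    (⁅P, Q⁆ : Matrix (Fin N) (Fin N) ℂ).trace = 0 := by
  rw [Ring.lie_def, Matrix.trace_sub, Matrix.trace_mul_comm, sub_self]

theorem isTwoCocycleOn_gammaTwo (D : LaxData X A) : IsTwoCocycleOn D.laxAlgebra D.gammaTwo where
  add_left L hL M hM L' hL' := gammaTwo_add_left (traceRegular_of_mem hL)
    (traceRegular_of_mem hM) (traceRegular_of_mem hL')
  add_right L hL L' hL' M hM := by
    have h := traceRegular_of_mem hL
    have h' := traceRegular_of_mem hL'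
    have hM := traceRegular_of_mem hM
    -- Additivity in the second argument follows from the first by antisymmetry.
    linear_combination gammaTwo_add_swap h (h'.add hM) - gammaTwo_add_left h' hM h
      - gammaTwo_add_swap h h' - gammaTwo_add_swap h hM
  smul_left c L hL L' hL' :=
    gammaTwo_smul_left c (traceRegular_of_mem hL) (traceRegular_of_mem hL')
  smul_right c L hL L' hL' := by
    have h := traceRegular_of_mem hL
    have h' := traceRegular_of_mem hL'
    have hc := traceRegular_of_mem (Submodule.smul_mem _ c hL')
    linear_combination gammaTwo_add_swap h hc - gammaTwo_smul_left c h' h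
      - c * gammaTwo_add_swap h h'
  antisymm L hL L' hL' := by
    linear_combination gammaTwo_add_swap (traceRegular_of_mem hL) (traceRegular_of_mem hL')
  jacobi L _ L' _ L'' _ := by
    -- Commutators are traceless, so each of the three terms vanishes by itself.
    rw [gammaTwo_eq_zero_of_trace_eq_zero fun x => trace_lie _ _,
      gammaTwo_eq_zero_of_trace_eq_zero fun x => trace_lie _ _,
      gammaTwo_eq_zero_of_trace_eq_zero fun x => trace_lie _ _]
    simp

/-! ### Invariance -/

omit [T2Space X] in
theorem connection_apply_eq (θ : MatForm X N) (e : VField X) {w : ℂ}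
    (hw : w ∈ D.zp.target) :
    θ (D.zp.symm w) (e (D.zp.symm w)) = fieldCoeff D.zp e w • matCoeff D.zp θ w := by
  rw [matCoeff, ← map_smul, ← eq_fieldCoeff_smul_coordVec D.zp_coord.1 e hw]

omit [T2Space X] in
theorem dfun_apply_eq {f : X → ℂ} (e : VField X) {w : ℂ} (hw : w ∈ D.zp.target)
    (hf : MDifferentiableAt 𝓘(ℂ) 𝓘(ℂ) f (D.zp.symm w)) :
    dfun f (D.zp.symm w) (e (D.zp.symm w))
      = fieldCoeff D.zp e w * deriv (f ∘ D.zp.symm) w := by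
  rw [eq_fieldCoeff_smul_coordVec D.zp_coord.1 e hw, map_smul,
    dfun_coordVec D.zp_coord.1 hw hf, smul_eq_mul]

/-- This makes the diagonal entries of ∇_e L holomorphic in a punctured neighbourhood of P₊, so that
tr d(∇_e L) is there the differential of the trace. -/
theorem meromorphicAt_nabla {θ : MatForm X N}
    (hθ : ∀ i j, MeromorphicAt (fun w => matCoeff D.zp θ w i j) 0) {e : VField X}
    (he : MeromorphicAt (fieldCoeff D.zp e) 0) {L : X → Matrix (Fin N) (Fin N) ℂ}
    (hL : L ∈ D.laxAlgebra) (i j : Fin N) :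
    MeromorphicAt ((fun x => D.nabla θ e L x i j) ∘ D.zp.symm) 0 := by
  have hLm : ∀ i j, MeromorphicAt ((fun x => L x i j) ∘ D.zp.symm) 0 := hL.2.2.2.1
  have h1 : ∀ i j k, MeromorphicAt (fun w => fieldCoeff D.zp e w * matCoeff D.zp θ w i k
      * ((fun x => L x k j) ∘ D.zp.symm) w) 0 := fun i j k => (he.mul (hθ i k)).mul (hLm k j)
  have h2 : ∀ i j k, MeromorphicAt (fun w => ((fun x => L x i k) ∘ D.zp.symm) w
      * (fieldCoeff D.zp e w * matCoeff D.zp θ w k j)) 0 := fun i j k =>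
    (hLm i k).mul (he.mul (hθ k j))
  have h3 : MeromorphicAt (fun w =>
      fieldCoeff D.zp e w * deriv ((fun x => L x i j) ∘ D.zp.symm) w
        + ((∑ k, fieldCoeff D.zp e w * matCoeff D.zp θ w i k
            * ((fun x => L x k j) ∘ D.zp.symm) w)
          - ∑ k, ((fun x => L x i k) ∘ D.zp.symm) w
            * (fieldCoeff D.zp e w * matCoeff D.zp θ w k j))) 0 :=
    (he.mul (hLm i j).deriv).add ((MeromorphicAt.fun_sum fun k _ => h1 i j k).sub
      (MeromorphicAt.fun_sum fun k _ => h2 i j k))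
  refine h3.congr ?_
  filter_upwards [D.eventually_notMem_marked D.zp_coord] with w hw
  simp only [Function.comp_apply, nabla, if_neg hw.2]
  rw [connection_apply_eq θ e hw.1, Matrix.add_apply, Matrix.of_apply,
    dfun_apply_eq e hw.1 (hL.2.2.1 _ hw.2 i j), Ring.lie_def, Matrix.sub_apply,
    Matrix.mul_apply, Matrix.mul_apply]
  simp [Matrix.smul_apply]

/-- The commutator with θ(e) has trace zero, so on traces ∇_e is the plain derivative along e. -/
theorem trace_nabla_eventuallyEq (θ : MatForm X N) (e : VField X)
    {L : X → Matrix (Fin N) (Fin N) ℂ} (hL : D.TraceRegular L) :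
    (fun x => (D.nabla θ e L x).trace) ∘ D.zp.symm =ᶠ[𝓝[≠] 0]
      fun w => fieldCoeff D.zp e w * deriv ((fun x => (L x).trace) ∘ D.zp.symm) w := by
  filter_upwards [D.eventually_notMem_marked D.zp_coord] with w hw
  have h1 : (fun x => (L x).trace) ∘ D.zp.symm
      = fun v => ∑ i, ((fun y => L y i i) ∘ D.zp.symm) v := rfl
  simp only [Function.comp_apply, nabla, if_neg hw.2]
  rw [Matrix.trace_add, trace_lie, add_zero, h1, deriv_fun_sum fun i _ =>
    differentiableAt_comp_symm D.zp_coord.1 hw.1 (hL.mdifferentiableAt _ hw.2 i), Finset.mul_sum]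
  simp only [Matrix.trace, Matrix.diag_apply, Matrix.of_apply]
  exact Finset.sum_congr rfl fun i _ => dfun_apply_eq e hw.1 (hL.mdifferentiableAt _ hw.2 i)

theorem isInvariant_gammaTwo {θ : MatForm X N} (hθ : D.IsConnectionForm θ) :
    D.IsInvariant θ D.gammaTwo := by
  intro e he L hL L' hL'
  have h := traceRegular_of_mem hL
  have h' := traceRegular_of_mem hL'
  have hv := he.2.1
  have hd : ∀ᶠ w in 𝓝[≠] (0 : ℂ), ∀ i,
      MDifferentiableAt 𝓘(ℂ) 𝓘(ℂ) (fun y => D.nabla θ e L' y i i) (D.zp.symm w) := by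
    have ha := eventually_all.2 fun i =>
      (meromorphicAt_nabla hθ.mero_Pp hv hL' i i).eventually_analyticAt
    filter_upwards [ha, D.eventually_notMem_marked D.zp_coord] with w hw hwt i
    refine mdifferentiableAt_of_comp_symm D.zp_coord.1 (D.zp.map_target hwt.1) ?_
    rw [D.zp.right_inv hwt.1]
    exact (hw i).differentiableAt
  set F := (fun x => (L x).trace) ∘ D.zp.symm with hF
  set G := (fun x => (L' x).trace) ∘ D.zp.symm with hG
  set v := fieldCoeff D.zp e with hv'
  have e1 := trace_nabla_eventuallyEq θ e h
  have e2 := trace_nabla_eventuallyEq θ e h'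
  have m1 : MeromorphicAt ((fun x => (D.nabla θ e L x).trace) ∘ D.zp.symm) 0 :=
    (hv.mul h.mero_Pp.deriv).congr e1.symm
  have m2 : MeromorphicAt ((fun x => (D.nabla θ e L' x).trace) ∘ D.zp.symm) 0 :=
    (hv.mul h'.mero_Pp.deriv).congr e2.symm
  have m3 : MeromorphicAt (fun w => v w * deriv G w) 0 := hv.mul h'.mero_Pp.deriv
  -- The two coefficients add up to vF'G' + F(vG')', the derivative of F·vG'.
  rw [h'.gammaTwo_eq, gammaTwo_eq_residueAtZero hd, ← residueAtZero_add
    (meromorphicAt_diffCoeff m1 h'.mero_Pp) (meromorphicAt_diffCoeff h.mero_Pp m2),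
    ← residueAtZero_deriv (h.mero_Pp.mul m3)]
  apply residueAtZero_congr
  filter_upwards [h.mero_Pp.eventually_analyticAt, m3.eventually_analyticAt, e1,
    e2.nhdsNE_deriv] with w h1 h2 h3 h4
  simp only [Function.comp_apply] at h3
  rw [deriv_mul h1.differentiableAt h2.differentiableAt, diffCoeff, diffCoeff, h3, h4]
  simp only [Function.comp_apply]
  ring

/-! ### Locality -/

/-- The residue theorem for `tr(L) tr(dL')`. -/
theorem residueAtZero_Pp_add_residueAtZero_Pm [CompactSpace X] [IsManifold 𝓘(ℂ) ω X]
    {L L' : X → Matrix (Fin N) (Fin N) ℂ} (h : D.TraceRegular L) (h' : D.TraceRegular L') :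
    residueAtZero (diffCoeff D.zp (fun x => (L x).trace) fun x => (L' x).trace)
      + residueAtZero (diffCoeff D.zm (fun x => (L x).trace) fun x => (L' x).trace) = 0 := by
  obtain ⟨f, hf, hfd⟩ := h.exists_extension
  obtain ⟨f', hf', hfd'⟩ := h'.exists_extension
  have key := sum_residueAtZero_diffCoeff_eq_zero (p := ![D.Pp, D.Pm])
    (by
      intro i j hij
      fin_cases i <;> fin_cases j <;> simp_all [D.Pp_ne_Pm, D.Pp_ne_Pm.symm])
    (z := ![D.zp, D.zm]) (by
      intro i
      fin_cases i
      exacts [D.zp_coord, D.zm_coord]) (f := f) (h := f')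
    (fun x hx => hfd x (fun e => hx ⟨0, e.symm⟩) fun e => hx ⟨1, e.symm⟩)
    (fun x hx => hfd' x (fun e => hx ⟨0, e.symm⟩) fun e => hx ⟨1, e.symm⟩)
  rw [Fin.sum_univ_two] at key
  rw [residueAtZero_congr (diffCoeff_congr (D.comp_symm_eventuallyEq D.zp_coord hf).symm
      (D.comp_symm_eventuallyEq D.zp_coord hf').symm),
    residueAtZero_congr (diffCoeff_congr (D.comp_symm_eventuallyEq D.zm_coord hf).symm
      (D.comp_symm_eventuallyEq D.zm_coord hf').symm)]
  exact key

variable (D) in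
/-- The trace of `L` has order at least `k` at `P₊` and at least `l` at `P₋`. -/
structure HasTraceOrders (k l : ℤ) (L : X → Matrix (Fin N) (Fin N) ℂ) : Prop
    extends D.TraceRegular L where
  order_Pp : IsOPow (fun w => (L (D.zp.symm w)).trace) k
  order_Pm : IsOPow (fun w => (L (D.zm.symm w)).trace) l

omit [T2Space X] in
theorem HasTraceOrders.add {k l : ℤ} {L M : X → Matrix (Fin N) (Fin N) ℂ}
    (h : D.HasTraceOrders k l L) (h' : D.HasTraceOrders k l M) :
    D.HasTraceOrders k l (L + M) where
  toTraceRegular := h.toTraceRegular.add h'.toTraceRegular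
  order_Pp := (h.order_Pp.add h'.order_Pp).congr
    (Eventually.of_forall fun _ => by simp [Matrix.trace_add])
  order_Pm := (h.order_Pm.add h'.order_Pm).congr
    (Eventually.of_forall fun _ => by simp [Matrix.trace_add])

omit [T2Space X] in
theorem HasTraceOrders.mono {k l l' : ℤ} {L : X → Matrix (Fin N) (Fin N) ℂ}
    (h : D.HasTraceOrders k l L) (hl : l' ≤ l) : D.HasTraceOrders k l' L :=
  ⟨h.toTraceRegular, h.order_Pp, h.order_Pm.mono hl⟩

/-- For k + m ≥ 1 the orders at P₊ kill the residue. For k + m < -2c the orders at P₋ add up to at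
least 1 and kill the residue there, and the two residues are opposite. -/
theorem isLocal_gammaTwo_of_hasTraceOrders [CompactSpace X] [IsManifold 𝓘(ℂ) ω X]
    {G : ℤ → Submodule ℂ (X → Matrix (Fin N) (Fin N) ℂ)} {c : ℤ}
    (hG : ∀ m, ∀ L ∈ G m, D.HasTraceOrders m (-m - c) L) : IsLocal G D.gammaTwo := by
  refine ⟨-2 * c, 0, fun k m L hL L' hL' hne => ?_⟩
  have h := hG k L hL
  have h' := hG m L' hL'
  have hres := residueAtZero_Pp_add_residueAtZero_Pm h.toTraceRegular h'.toTraceRegular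
  rw [h'.toTraceRegular.gammaTwo_eq] at hne
  constructor
  · by_contra! hlt
    have h0 := residueAtZero_mul_deriv_eq_zero h.mero_Pm h'.mero_Pm h.order_Pm h'.order_Pm
      (by omega)
    refine hne ?_
    rwa [show residueAtZero (diffCoeff D.zm (fun x => (L x).trace) fun x => (L' x).trace) = 0
      from h0, add_zero] at hres
  · by_contra! hlt
    exact hne (residueAtZero_mul_deriv_eq_zero h.mero_Pp h'.mero_Pp h.order_Pp h'.order_Pp
      (by omega))

theorem isLocal_of_isOrderFamily [CompactSpace X] [IsManifold 𝓘(ℂ) ω X]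
    {G : ℤ → Submodule ℂ (X → Matrix (Fin N) (Fin N) ℂ)} (hG : D.IsOrderFamily G) :
    IsLocal G D.gammaTwo := by
  obtain ⟨h1, c, h2⟩ := hG
  exact isLocal_gammaTwo_of_hasTraceOrders fun m L hL =>
    ⟨traceRegular_of_mem (h1 m hL), (h2 m L hL).1.trace, (h2 m L hL).2.trace⟩

omit [T2Space X] in
theorem hasTraceOrders_of_mem_orderSpace {V : Submodule ℂ (Matrix (Fin N) (Fin N) ℂ)} {m : ℤ}
    {L : X → Matrix (Fin N) (Fin N) ℂ} (hL : L ∈ D.orderSpace V m) :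
    D.HasTraceOrders m (-m - genus X) L := by
  obtain ⟨h1, -, ⟨Y, -, h3⟩, ⟨Z, -, h4⟩⟩ := hL
  exact ⟨traceRegular_of_mem h1, h3.of_sub_zpow_smul.trace, h4.of_sub_zpow_smul.trace⟩

/-- Only traces matter, so the matrix conditions at the γ_s need not be checked for f·Y: its trace
is a multiple of f, which is holomorphic at the γ_s. -/
theorem hasTraceOrders_of_mem_currents {V : Submodule ℂ (Matrix (Fin N) (Fin N) ℂ)} {f : X → ℂ}
    (hf : f ∈ D.functionAlgebra) {k l : ℤ} (hk : IsOPow (fun w => f (D.zp.symm w)) k)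
    (hl : IsOPow (fun w => f (D.zm.symm w)) l) {L : X → Matrix (Fin N) (Fin N) ℂ}
    (hL : L ∈ D.currents V f) : D.HasTraceOrders k l L := by
  obtain ⟨Y, -, rfl⟩ := hL
  have ht : ∀ x ∉ D.marked, Y.trace * f x = (D.currentMap f Y x).trace := by
    intro x hx
    simp [currentMap, hx, mul_comm]
  refine ⟨⟨fun x hx i => ?_, fun s => ?_, ?_, ?_⟩, ?_, ?_⟩
  · have hp : x ≠ D.Pp := fun h => hx (Or.inr (Or.inl h))
    have hm : x ≠ D.Pm := fun h => hx (Or.inr (Or.inr h))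
    refine ((hf.2.1 x hp hm).const_smul (Y i i)).congr_of_eventuallyEq ?_
    filter_upwards [D.finite_marked.isClosed.isOpen_compl.mem_nhds hx] with y hy
    have hy : y ∉ D.marked := hy
    simp [currentMap, hy, mul_comm]
  · have hz := D.z_coord s
    have hd : DifferentiableAt ℂ (f ∘ (D.z s).symm) 0 := by
      apply differentiableAt_comp_symm hz.1 hz.zero_mem_target
      rw [hz.symm_zero]
      exact hf.2.1 _ (D.pt_ne_Pp s) (D.pt_ne_Pm s)
    have hO : IsOPow (f ∘ (D.z s).symm) 0 := by
      simp only [IsOPow, zpow_zero]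
      exact (hd.continuousAt.isBigO_one ℂ).mono nhdsWithin_le_nhds
    exact (hO.const_mul_left Y.trace).congr'
      (D.comp_symm_eventuallyEq hz (f := fun x => Y.trace * f x) ht) .rfl
  · exact ((MeromorphicAt.const Y.trace 0).mul hf.2.2.1).congr
      (D.comp_symm_eventuallyEq D.zp_coord ht)
  · exact ((MeromorphicAt.const Y.trace 0).mul hf.2.2.2).congr
      (D.comp_symm_eventuallyEq D.zm_coord ht)
  · exact (hk.const_mul_left Y.trace).congr' (D.comp_symm_eventuallyEq D.zp_coord ht) .rfl
  · exact (hl.const_mul_left Y.trace).congr' (D.comp_symm_eventuallyEq D.zm_coord ht) .rfl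

theorem isLocal_homogeneous [CompactSpace X] [IsManifold 𝓘(ℂ) ω X] {a : ℤ → X → ℂ}
    (ha : D.IsKNBasis a) : IsLocal (D.homogeneous a) D.gammaTwo := by
  obtain ⟨c, hc⟩ := ha.order_Pm
  -- The constant must serve both kinds of summands: c comes from the basis and g from the order
  -- spaces, hence the maximum.
  have hcur : ∀ m V, ∀ L ∈ D.currents V (a m),
      D.HasTraceOrders m (-m - max c (genus X)) L := fun m V L hL =>
    hasTraceOrders_of_mem_currents (ha.mem m) (ha.order_Pp m).of_sub_zpow
      ((hc m).mono (by omega)) hL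
  have hord : ∀ m V, ∀ L ∈ D.orderSpace V m,
      D.HasTraceOrders m (-m - max c (genus X)) L := fun m V L hL =>
    (hasTraceOrders_of_mem_orderSpace hL).mono (by omega)
  refine isLocal_gammaTwo_of_hasTraceOrders (c := max c (genus X)) fun m L hL => ?_
  unfold homogeneous at hL
  split_ifs at hL
  · exact hcur m _ L hL
  · exact hord m _ L hL
  · obtain ⟨L₁, h1, L₂, h2, rfl⟩ := Submodule.mem_sup.1 hL
    exact (hord m _ L₁ h1).add (hcur m _ L₂ h2)

end LaxData
end LaxOperator

theorem mainTheorem12 {X : Type*} [TopologicalSpace X] [T2Space X] [CompactSpace X]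
    [ConnectedSpace X] [ChartedSpace ℂ X] [IsManifold 𝓘(ℂ) ω X]
    {n N : ℕ} (A : LaxOperator.MatAlg n N) (D : LaxOperator.LaxData X A) :
    -- `tr(L) · tr(dL')` is a meromorphic differential without poles outside `P₊`, `P₋`
    (∀ L ∈ D.laxAlgebra, ∀ L' ∈ D.laxAlgebra, ∀ (p : X) (z : OpenPartialHomeomorph X ℂ),
      LaxOperator.IsCoord z p →
        MeromorphicAt (LaxOperator.formCoeff z (LaxOperator.traceForm L L')) 0 ∧
        (p ≠ D.Pp → p ≠ D.Pm →
          0 ≤ meromorphicOrderAt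
            (LaxOperator.formCoeff z (LaxOperator.traceForm L L')) 0)) ∧
    -- `γ₂` is a cocycle
    LaxOperator.IsTwoCocycleOn D.laxAlgebra D.gammaTwo ∧
    -- it is invariant
    (∀ θ : LaxOperator.MatForm X N, D.IsConnectionForm θ → D.IsInvariant θ D.gammaTwo) ∧
    -- it is local
    (∀ a : ℤ → X → ℂ, D.IsKNBasis a → LaxOperator.IsLocal (D.homogeneous a) D.gammaTwo) ∧
    (∀ G : ℤ → Submodule ℂ (X → Matrix (Fin N) (Fin N) ℂ), D.IsOrderFamily G →
      LaxOperator.IsLocal G D.gammaTwo) := by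
  refine ⟨fun L hL L' hL' p z hz => ?_, D.isTwoCocycleOn_gammaTwo, fun θ hθ => ?_,
    fun a ha => ?_, fun G hG => ?_⟩
  · exact LaxOperator.LaxData.meromorphicAt_formCoeff_traceForm
      (LaxOperator.LaxData.traceRegular_of_mem hL) (LaxOperator.LaxData.traceRegular_of_mem hL') hz
  · exact LaxOperator.LaxData.isInvariant_gammaTwo hθ
  · exact LaxOperator.LaxData.isLocal_homogeneous ha
  · exact LaxOperator.LaxData.isLocal_of_isOrderFamily hG
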